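/- **Conventions.** For a graph $G$ on $V=\{1,\dots,n\}$, the graph state $|G\rangle$ is the $n$-qubit state (unique up to phase) stabilized by $X_v\otimes\bigotimes_{w\in N_G(v)}Z_w$ for all $v\in V$. Consider adaptive quantum algorithms made of single-qubit Clifford operations, two-qubit Clifford operations, and computational-basis measurements of qubits, where measured qubits are discarded and later operations may depend on the outcomes. The CZ-complexity of such an algorithm is the maximum, over the measurement outcomes, of the number of its two-qubit Clifford operations. $\Gamma_{\mathrm{CZ}}(|G\rangle)$ is the minimum CZ-complexity of an algorithm that generates $|G\rangle$ from $|0\rangle^{\otimes(n+s)}$ with probability $1$, for some $s\ge 0$. Let $m$ be a double occurrence word over $V$, i.e. a word in which every letter of $V$ appears exactly twice. In the interval graph of $m$, distinct $a,b$ are adjacent iff they appear in $m$ in the order $abba$, $baab$, $abab$ or $baba$; in the interval containment graph of $m$, iff they appear in the order $abba$ or $baab$; in the circle graph of $m$, iff they appear in the order $abab$ or $baba$. An interval graph (interval containment graph, circle graph) is the one of some double occurrence word. The local complementation at a vertex $v$ complements all pairs of distinct neighbours of $v$; two graphs are local-complement equivalent if a sequence of local complementations transforms one into the other. Throughout, $\log=\log_2$.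 **Theorem.** Let $n\ge1$. 1. Every interval graph $G$ with $n$ vertices satisfies $\Gamma_{\mathrm{CZ}}(|G\rangle)\le 2n-2$, and some algorithm with one auxiliary qubit ($s=1$) attains this bound. On graphs, the following explicit algorithm, with exactly $2n-2$ edge complementations, generates the interval graph of a double occurrence word $m$: start with the edgeless graph on $V\cup\{z\}$; read the letters of $m$ except the last two; for a letter $a$ that appears for the first time, apply a local complementation at $z$, complement the pair $\{a,z\}$, and apply a local complementation at $z$; for a letter $a$ that appears for the second time, complement the pair $\{a,z\}$; finally delete $z$. 2. Every circle graph $G$ with $n$ vertices is local-complement equivalent to a circle graph that has a vertex of degree at most $2\lfloor\log_3(n+1)\rfloor$, and $$\Gamma_{\mathrm{CZ}}(|G\rangle)\le 2\lfloor\log_3(n+1)\rfloor\,(n-1),$$ where $2\lfloor\log_3(n+1)\rfloor(n-1)\le 1.262\,(n-1)\log(n+1)$ and $2\lfloor\log_3(n+1)\rfloor(n-1)\le 1.262\,n\log n$. 3. There is a constant $C$ such that, for all $n\ge1$, every interval containment graph $G$ with $n$ vertices satisfies $\Gamma_{\mathrm{CZ}}(|G\rangle)\le 1.262\,n\log n+Cn$.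 -/

import Mathlib

noncomputable section

namespace GraphPrep

/-! ## Pauli operators and Clifford operators -/

/-- The Pauli matrix `X`. -/
def pauliX : Matrix (Fin 2) (Fin 2) ℂ := !![0, 1; 1, 0]

/-- The Pauli matrix `Y`. -/
def pauliY : Matrix (Fin 2) (Fin 2) ℂ := !![0, -Complex.I; Complex.I, 0]

/-- The Pauli matrix `Z`. -/
def pauliZ : Matrix (Fin 2) (Fin 2) ℂ := !![1, 0; 0, -1]

/-- Operators on `k` qubits; the computational basis is indexed by the bit strings
`Fin k → Fin 2`. -/
abbrev Op (k : ℕ) : Type := Matrix (Fin k → Fin 2) (Fin k → Fin 2) ℂ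

/-- The tensor product `h 0 ⊗ h 1 ⊗ ⋯ ⊗ h (k - 1)` of single-qubit operators. -/
def tensor {k : ℕ} (h : Fin k → Matrix (Fin 2) (Fin 2) ℂ) : Op k :=
  Matrix.of fun x y => ∏ i, h i (x i) (y i)

/-- The Pauli group on `k` qubits: all `α h₁ ⊗ ⋯ ⊗ h_k` with `α ∈ {±1, ±i}` and
`h_j ∈ {I, X, Y, Z}`. -/
def pauliGroup (k : ℕ) : Set (Op k) :=
  {P | ∃ α ∈ ({1, -1, Complex.I, -Complex.I} : Set ℂ),
    ∃ h : Fin k → Matrix (Fin 2) (Fin 2) ℂ,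
      (∀ j, h j ∈ ({1, pauliX, pauliY, pauliZ} : Set (Matrix (Fin 2) (Fin 2) ℂ))) ∧
      P = α • tensor h}

/-- `U` is a Clifford operator on `k` qubits: `U` is unitary and conjugation by `U` maps the
Pauli group onto itself. -/
def IsClifford {k : ℕ} (U : Op k) : Prop :=
  U ∈ Matrix.unitaryGroup (Fin k → Fin 2) ℂ ∧
    (fun P : Op k => U * P * U.conjTranspose) '' pauliGroup k = pauliGroup k

/-! ## States, gates and measurements -/

/-- Vectors of amplitudes of `N` qubits. They are not required to be normalized, and a nonzero
vector stands for the quantum state obtained by normalizing it. -/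
abbrev State (N : ℕ) : Type := (Fin N → Fin 2) → ℂ

/-- The state `|0⟩ ⊗ ⋯ ⊗ |0⟩` on `N` qubits. -/
def zeroState (N : ℕ) : State N := Pi.single 0 1

/-- Apply the `k`-qubit operator `U` to the qubits `q 0, …, q (k - 1)` of an `N`-qubit state,
and the identity to the other qubits. The string `Function.extend q y x` agrees with `y` on the
qubits in the range of `q`, and with `x` elsewhere. -/
def applyGate {k N : ℕ} (U : Op k) (q : Fin k ↪ Fin N) (ψ : State N) : State N :=
  fun x => ∑ y : Fin k → Fin 2, U (fun j => x (q j)) y * ψ (Function.extend q y x)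

/-- The (unnormalized) state of the remaining `N` qubits after qubit `q` has been measured in the
computational basis with outcome `b` and then discarded. Its squared norm, divided by that of `ψ`,
is the probability of the outcome. The remaining qubits keep their order. -/
def postMeasure {N : ℕ} (q : Fin (N + 1)) (b : Fin 2) (ψ : State (N + 1)) : State N :=
  fun x => ψ (Fin.insertNth (α := fun _ => Fin 2) q b x)

/-! ## Graph states -/

open Classical in
/-- The stabilizer generator `X_v ⊗ ⨂_{w ∈ N_G(v)} Z_w`. -/
def graphStabilizer {n : ℕ} (G : SimpleGraph (Fin n)) (v : Fin n) : Op n :=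
  tensor fun w => if w = v then pauliX else if G.Adj v w then pauliZ else 1

/-- `ψ` is, up to a nonzero factor, the graph state of `G`: it is stabilized by all the
generators. -/
def IsGraphState {n : ℕ} (G : SimpleGraph (Fin n)) (ψ : State n) : Prop :=
  ψ ≠ 0 ∧ ∀ v, (graphStabilizer G v).mulVec ψ = ψ

/-! ## Adaptive algorithms and the CZ-complexity -/

/-- `QAlg n N` is the type of adaptive quantum algorithms that act on `N` qubits and end with `n`
qubits. They consist of single-qubit Clifford operations, two-qubit Clifford operations, and
computational basis measurements. A measured qubit is discarded, and the remainder of the algorithm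
may depend on the outcome. -/
inductive QAlg (n : ℕ) : ℕ → Type
  | done : QAlg n n
  | gate₁ {N : ℕ} (U : Op 1) (hU : IsClifford U) (q : Fin 1 ↪ Fin N) (A : QAlg n N) : QAlg n N
  | gate₂ {N : ℕ} (U : Op 2) (hU : IsClifford U) (q : Fin 2 ↪ Fin N) (A : QAlg n N) : QAlg n N
  | measure {N : ℕ} (q : Fin (N + 1)) (A : Fin 2 → QAlg n N) : QAlg n (N + 1)

/-- The CZ-complexity of an algorithm: the maximum, over the measurement outcomes, of the number
of two-qubit Clifford operations. -/
def QAlg.cost {n : ℕ} : {N : ℕ} → QAlg n N → ℕ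
  | _, .done => 0
  | _, .gate₁ _ _ _ A => A.cost
  | _, .gate₂ _ _ _ A => A.cost + 1
  | _, .measure _ A => max (A 0).cost (A 1).cost

/-- Started in the state `ψ`, the algorithm ends with probability 1 in the graph state of `G`:
it does so for every sequence of measurement outcomes of positive probability. -/
def QAlg.Generates {n : ℕ} (G : SimpleGraph (Fin n)) : {N : ℕ} → QAlg n N → State N → Prop
  | _, .done, ψ => IsGraphState G ψ
  | _, .gate₁ U _ q A, ψ => A.Generates G (applyGate U q ψ)
  | _, .gate₂ U _ q A, ψ => A.Generates G (applyGate U q ψ)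
  | _, .measure q A, ψ =>
      ∀ b, postMeasure q b ψ ≠ 0 → (A b).Generates G (postMeasure q b ψ)

/-- The CZ-complexity of the graph state of `G`: the minimum of the CZ-complexities of the
algorithms that generate it from `n + s` qubits in the state `|0⟩`, for some `s ≥ 0`
(it would be `⊤` if there were none). -/
def czComplexity {n : ℕ} (G : SimpleGraph (Fin n)) : ℕ∞ :=
  ⨅ (s : ℕ) (A : QAlg n (n + s)) (_ : A.Generates G (zeroState (n + s))), (A.cost : ℕ∞)

/-! ## Graph classes defined by double occurrence words -/

section Words

variable {V : Type*} [DecidableEq V]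

/-- A double occurrence word over `V`: every letter appears exactly twice. -/
def IsDoubleOccurrence (m : List V) : Prop := ∀ a, m.count a = 2

/-- The subword of `m` formed by the letters `a` and `b`. -/
def subword (m : List V) (a b : V) : List V := m.filter fun x => x = a ∨ x = b

/-- `a` and `b` appear in `m` in the order `abba` (or `baab`). -/
def Nested (m : List V) (a b : V) : Prop :=
  subword m a b = [a, b, b, a] ∨ subword m a b = [b, a, a, b]

/-- `a` and `b` appear in `m` in the order `abab` (or `baba`). -/
def Alternating (m : List V) (a b : V) : Prop :=
  subword m a b = [a, b, a, b] ∨ subword m a b = [b, a, b, a]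

theorem subword_comm (m : List V) (a b : V) : subword m a b = subword m b a := by
  unfold subword; congr 1; funext x; simp [or_comm]

theorem Nested.symm {m : List V} {a b : V} (h : Nested m a b) : Nested m b a := by
  unfold Nested at *; rw [subword_comm m b a]; exact h.symm

theorem Alternating.symm {m : List V} {a b : V} (h : Alternating m a b) :
    Alternating m b a := by
  unfold Alternating at *; rw [subword_comm m b a]; exact h.symm

/-- The interval graph of a double occurrence word. -/
def intervalGraph (m : List V) : SimpleGraph V where
  Adj a b := a ≠ b ∧ (Nested m a b ∨ Alternating m a b)
  symm := ⟨fun _ _ h => ⟨h.1.symm, h.2.imp Nested.symm Alternating.symm⟩⟩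
  loopless := ⟨fun _ h => h.1 rfl⟩

/-- The interval containment graph of a double occurrence word. -/
def containmentGraph (m : List V) : SimpleGraph V where
  Adj a b := a ≠ b ∧ Nested m a b
  symm := ⟨fun _ _ h => ⟨h.1.symm, h.2.symm⟩⟩
  loopless := ⟨fun _ h => h.1 rfl⟩

/-- The circle graph of a double occurrence word. -/
def circleGraph (m : List V) : SimpleGraph V where
  Adj a b := a ≠ b ∧ Alternating m a b
  symm := ⟨fun _ _ h => ⟨h.1.symm, h.2.symm⟩⟩
  loopless := ⟨fun _ h => h.1 rfl⟩

def IsIntervalGraph (G : SimpleGraph V) : Prop :=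
  ∃ m, IsDoubleOccurrence m ∧ G = intervalGraph m

def IsIntervalContainmentGraph (G : SimpleGraph V) : Prop :=
  ∃ m, IsDoubleOccurrence m ∧ G = containmentGraph m

def IsCircleGraph (G : SimpleGraph V) : Prop :=
  ∃ m, IsDoubleOccurrence m ∧ G = circleGraph m

end Words

/-! ## Graph operations -/

section Operations

variable {V : Type*}

/-- The local complementation at `v`: complement all pairs of distinct neighbours of `v`. -/
def localCompl (v : V) (G : SimpleGraph V) : SimpleGraph V where
  Adj u w := u ≠ w ∧ Xor (G.Adj u w) (G.Adj v u ∧ G.Adj v w)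
  symm := ⟨fun _ _ h => ⟨h.1.symm, by rw [G.adj_comm, and_comm]; exact h.2⟩⟩
  loopless := ⟨fun _ h => h.1 rfl⟩

/-- The complementation of the pair `{a, b}` (for `a ≠ b`). -/
def edgeCompl (a b : V) (G : SimpleGraph V) : SimpleGraph V where
  Adj u w := u ≠ w ∧ Xor (G.Adj u w) (s(u, w) = s(a, b))
  symm := ⟨fun _ _ h => ⟨h.1.symm, by rw [G.adj_comm, Sym2.eq_swap]; exact h.2⟩⟩
  loopless := ⟨fun _ h => h.1 rfl⟩

/-- Two graphs are local-complement equivalent if one is transformed into the other by a sequence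
of local complementations (each of which is an involution). -/
def LocallyEquivalent (G H : SimpleGraph V) : Prop :=
  Relation.ReflTransGen (fun G₁ G₂ => ∃ v, G₂ = localCompl v G₁) G H

/-- Local complementations (free) and edge complementations (of cost one). -/
inductive GraphOp (V : Type*)
  | localCompl (v : V) : GraphOp V
  | edgeCompl (a b : V) : GraphOp V

/-- The effect of one operation. -/
def GraphOp.apply (G : SimpleGraph V) : GraphOp V → SimpleGraph V
  | .localCompl v => GraphPrep.localCompl v G
  | .edgeCompl a b => GraphPrep.edgeCompl a b G

/-- The cost of one operation. -/
def GraphOp.cost : GraphOp V → ℕ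
  | .localCompl _ => 0
  | .edgeCompl _ _ => 1

/-- Run a list of operations, from left to right, on the edgeless graph. -/
def runOps (ops : List (GraphOp V)) : SimpleGraph V := ops.foldl GraphOp.apply ⊥

/-- The total cost of a list of operations. -/
def costOps (ops : List (GraphOp V)) : ℕ := (ops.map GraphOp.cost).sum

variable [DecidableEq V]

/-- The operations for one letter `a` of the word; the auxiliary vertex `z` is `none`. -/
def letterOps (first : Bool) (a : V) : List (GraphOp (Option V)) :=
  if first then [.localCompl none, .edgeCompl (some a) none, .localCompl none]
  else [.edgeCompl (some a) none]

/-- The algorithm that generates the interval graph of `m`: it reads all letters of `m` but the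
last two, and treats a letter according to whether it appears for the first time. The auxiliary
vertex is deleted at the end. -/
def intervalOps (m : List V) : List (GraphOp (Option V)) :=
  ((m.take (m.length - 2)).zipIdx).flatMap fun p => letterOps (p.1 ∉ m.take p.2) p.1

end Operations

end GraphPrep

end

noncomputable section

namespace GraphPrep

open Complex

/-! ## Clifford gates -/

/-! The quantum statement reduces to a statement on graphs. The amplitudes of a graph state satisfy
`ψ (flip v x) = (-1) ^ nbrSum G v x * ψ x`. With this description, a CZ gate complements a pair of
vertices, a `sqrtX` gate at `v` together with phase gates on its neighbours performs the local
complementation at `v`, and a measured qubit is a deleted vertex, up to `Z` gates. So it suffices to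
build `G` from the edgeless graph by free local complementations and edge complementations of cost
one (`reach_runOps`, `exists_alg_of_runOps`).

Interval graphs: the auxiliary vertex is kept adjacent to exactly the letters that are currently
open, i.e. read once. Local complementations at it before and after joining a new letter to it
cancel on pairs of open letters, so they join the new letter to the open ones and do nothing else
among the letters.

Circle graphs: a double occurrence word is an Eulerian circuit of a multigraph on its letters in
which all degrees are four. By a Moore-type count (`exists_short_cycle`), a multigraph of this kind
with `w` vertices contains a nonempty set of at most `2 * Nat.log 3 (w + 1) + 1` edges with even
degrees. Let `D` consist of the letters at which the circuit enters or leaves this set. The product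
of the stabilizer generators in `D` acts only on vertices that the edge set meets
(`exists_small_support`). Suitable local complementations shrink `D` without enlarging the support,
until some vertex of `D` has its closed neighbourhood inside the support; its degree is then at most
`2 * Nat.log 3 (w + 1)` (`exists_low_degree`). Circle graphs are closed under local complementation,
which reverses the subword between the two occurrences of a letter, and under deletion of a letter.
Hence the graph is built by induction: generate the rest, attach the vertex of low degree edge by
edge, and undo the local complementations.

Interval containment graphs are circle graphs, so the same bound holds for them, even with the
constant 0. -/

theorem tensor_mul {k : ℕ} (g h : Fin k → Matrix (Fin 2) (Fin 2) ℂ) :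
    tensor g * tensor h = tensor fun i => g i * h i := by
  ext x y
  simp only [tensor, Matrix.mul_apply, Matrix.of_apply, ← Finset.prod_mul_distrib]
  rw [Finset.prod_univ_sum, Fintype.piFinset_univ]

theorem tensor_conjTranspose {k : ℕ} (h : Fin k → Matrix (Fin 2) (Fin 2) ℂ) :
    (tensor h).conjTranspose = tensor fun i => (h i).conjTranspose := by
  ext x y
  simp [tensor, Matrix.conjTranspose_apply]

theorem tensor_one {k : ℕ} : tensor (fun _ : Fin k => (1 : Matrix (Fin 2) (Fin 2) ℂ)) = 1 := by
  ext x y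
  simp only [tensor, Matrix.of_apply, Matrix.one_apply]
  rw [Finset.prod_ite_zero]
  simp [funext_iff]

/-- Finiteness makes an injective conjugation of the Pauli group into itself onto, so that only one
inclusion has to be checked for a Clifford operator. -/
theorem pauliGroup_finite (k : ℕ) : (pauliGroup k).Finite := by
  have h1 : (Set.pi Set.univ fun _ : Fin k =>
      ({1, pauliX, pauliY, pauliZ} : Set (Matrix (Fin 2) (Fin 2) ℂ))).Finite :=
    Set.Finite.pi fun _ => Set.toFinite _
  have h2 : ({1, -1, I, -I} : Set ℂ).Finite := by simp
  refine (h2.image2 (fun α h => α • tensor h) h1).subset ?_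
  rintro P ⟨α, hα, h, hh, rfl⟩
  exact ⟨α, hα, h, fun j _ => hh j, rfl⟩

theorem unit_mul_mem {α β : ℂ} (hα : α ∈ ({1, -1, I, -I} : Set ℂ))
    (hβ : β ∈ ({1, -1, I, -I} : Set ℂ)) : α * β ∈ ({1, -1, I, -I} : Set ℂ) := by
  simp only [Set.mem_insert_iff, Set.mem_singleton_iff] at *
  rcases hα with rfl | rfl | rfl | rfl <;> rcases hβ with rfl | rfl | rfl | rfl <;> simp

theorem smul_mem_pauliGroup {k : ℕ} {α : ℂ} (hα : α ∈ ({1, -1, I, -I} : Set ℂ)) {P : Op k}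
    (hP : P ∈ pauliGroup k) : α • P ∈ pauliGroup k := by
  obtain ⟨β, hβ, h, hh, rfl⟩ := hP
  exact ⟨α * β, unit_mul_mem hα hβ, h, hh, by rw [mul_smul]⟩

/-- A unitary that conjugates all Pauli strings into the Pauli group is a Clifford operator. -/
theorem isClifford_of_conj {k : ℕ} {U : Op k} (hU : U.conjTranspose * U = 1)
    (h : ∀ h : Fin k → Matrix (Fin 2) (Fin 2) ℂ,
      (∀ j, h j ∈ ({1, pauliX, pauliY, pauliZ} : Set (Matrix (Fin 2) (Fin 2) ℂ))) →
      U * tensor h * U.conjTranspose ∈ pauliGroup k) : IsClifford U := by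
  refine ⟨Matrix.mem_unitaryGroup_iff'.2 hU, ?_⟩
  have hmaps : Set.MapsTo (fun P : Op k => U * P * U.conjTranspose) (pauliGroup k)
      (pauliGroup k) := by
    rintro P ⟨α, hα, g, hg, rfl⟩
    simp only [mul_smul_comm, smul_mul_assoc]
    exact smul_mem_pauliGroup hα (h g hg)
  have hinj : Function.Injective (fun P : Op k => U * P * U.conjTranspose) := by
    intro P Q hPQ
    have := congrArg (fun M => U.conjTranspose * M * U) hPQ
    simp only [← mul_assoc, hU, one_mul] at this
    simpa only [mul_assoc, hU, mul_one] using this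
  exact Set.eq_of_subset_of_ncard_le hmaps.image_subset
    (Set.ncard_image_of_injective _ hinj).ge (pauliGroup_finite k)

/-- A single-qubit operator as an operator on one qubit. -/
def single (u : Matrix (Fin 2) (Fin 2) ℂ) : Op 1 := tensor fun _ => u

theorem isClifford_single {u : Matrix (Fin 2) (Fin 2) ℂ} (hu : u.conjTranspose * u = 1)
    (h : ∀ P ∈ ({1, pauliX, pauliY, pauliZ} : Set (Matrix (Fin 2) (Fin 2) ℂ)),
      ∃ α ∈ ({1, -1, I, -I} : Set ℂ),
        ∃ Q ∈ ({1, pauliX, pauliY, pauliZ} : Set (Matrix (Fin 2) (Fin 2) ℂ)),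
          u * P * u.conjTranspose = α • Q) : IsClifford (single u) := by
  refine isClifford_of_conj ?_ fun g hg => ?_
  · rw [single, tensor_conjTranspose, tensor_mul, hu, tensor_one]
  · obtain ⟨α, hα, Q, hQ, e⟩ := h (g 0) (hg 0)
    refine ⟨α, hα, fun _ => Q, fun _ => hQ, ?_⟩
    rw [single, tensor_conjTranspose, tensor_mul, tensor_mul]
    ext x y
    simpa [tensor] using congrFun (congrFun e (x 0)) (y 0)

/-- The phase gate `diag(1, ω)`. -/
def phaseGate (ω : ℂ) : Matrix (Fin 2) (Fin 2) ℂ := !![1, 0; 0, ω]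

/-- The square root of `X`. -/
def sqrtX : Matrix (Fin 2) (Fin 2) ℂ := !![(1 + I) / 2, (1 - I) / 2; (1 - I) / 2, (1 + I) / 2]

theorem isClifford_phaseGate {ω : ℂ} (hω : ω ∈ ({1, -1, I, -I} : Set ℂ)) :
    IsClifford (single (phaseGate ω)) := by
  simp only [Set.mem_insert_iff, Set.mem_singleton_iff] at hω
  refine isClifford_single ?_ ?_
  · rcases hω with rfl | rfl | rfl | rfl <;> ext i j <;> fin_cases i <;> fin_cases j <;>
      simp [phaseGate, Matrix.mul_apply]
  · have hX : ∃ α ∈ ({1, -1, I, -I} : Set ℂ),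
        ∃ Q ∈ ({1, pauliX, pauliY, pauliZ} : Set (Matrix (Fin 2) (Fin 2) ℂ)),
          phaseGate ω * pauliX * (phaseGate ω).conjTranspose = α • Q := by
      rcases hω with rfl | rfl | rfl | rfl
      · refine ⟨1, by simp, pauliX, by simp, ?_⟩
        ext i j; fin_cases i <;> fin_cases j <;> simp [phaseGate, Matrix.mul_apply, pauliX]
      · refine ⟨-1, by simp, pauliX, by simp, ?_⟩
        ext i j; fin_cases i <;> fin_cases j <;> simp [phaseGate, Matrix.mul_apply, pauliX]
      · refine ⟨1, by simp, pauliY, by simp, ?_⟩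
        ext i j; fin_cases i <;> fin_cases j <;> simp [phaseGate, Matrix.mul_apply, pauliX, pauliY]
      · refine ⟨-1, by simp, pauliY, by simp, ?_⟩
        ext i j; fin_cases i <;> fin_cases j <;> simp [phaseGate, Matrix.mul_apply, pauliX, pauliY]
    have hY : ∃ α ∈ ({1, -1, I, -I} : Set ℂ),
        ∃ Q ∈ ({1, pauliX, pauliY, pauliZ} : Set (Matrix (Fin 2) (Fin 2) ℂ)),
          phaseGate ω * pauliY * (phaseGate ω).conjTranspose = α • Q := by
      rcases hω with rfl | rfl | rfl | rfl
      · refine ⟨1, by simp, pauliY, by simp, ?_⟩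
        ext i j; fin_cases i <;> fin_cases j <;> simp [phaseGate, Matrix.mul_apply, pauliY]
      · refine ⟨-1, by simp, pauliY, by simp, ?_⟩
        ext i j; fin_cases i <;> fin_cases j <;> simp [phaseGate, Matrix.mul_apply, pauliY]
      · refine ⟨-1, by simp, pauliX, by simp, ?_⟩
        ext i j; fin_cases i <;> fin_cases j <;> simp [phaseGate, Matrix.mul_apply, pauliX, pauliY]
      · refine ⟨1, by simp, pauliX, by simp, ?_⟩
        ext i j; fin_cases i <;> fin_cases j <;> simp [phaseGate, Matrix.mul_apply, pauliX, pauliY]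
    rintro P (rfl | rfl | rfl | rfl)
    · refine ⟨1, by simp, 1, by simp, ?_⟩
      rcases hω with rfl | rfl | rfl | rfl <;> ext i j <;> fin_cases i <;> fin_cases j <;>
        simp [phaseGate, Matrix.mul_apply]
    · exact hX
    · exact hY
    · refine ⟨1, by simp, pauliZ, by simp, ?_⟩
      rcases hω with rfl | rfl | rfl | rfl <;> ext i j <;> fin_cases i <;> fin_cases j <;>
        simp [phaseGate, Matrix.mul_apply, pauliZ]

theorem sqrtX_conjTranspose : sqrtX.conjTranspose =
    !![(1 - I) / 2, (1 + I) / 2; (1 + I) / 2, (1 - I) / 2] := by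
  ext i j; fin_cases i <;> fin_cases j <;> simp [sqrtX, sub_eq_add_neg]

theorem sqrtX_conj (P Q : Matrix (Fin 2) (Fin 2) ℂ)
    (h : sqrtX * P = Q * sqrtX) : sqrtX * P * sqrtX.conjTranspose = Q := by
  have : sqrtX * sqrtX.conjTranspose = 1 := by
    rw [sqrtX_conjTranspose]
    ext i j; fin_cases i <;> fin_cases j <;>
      simp [sqrtX, Matrix.mul_apply, Complex.ext_iff] <;> norm_num
  rw [h, mul_assoc, this, mul_one]

theorem isClifford_sqrtX : IsClifford (single sqrtX) := by
  refine isClifford_single ?_ ?_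
  · rw [sqrtX_conjTranspose]
    ext i j; fin_cases i <;> fin_cases j <;>
      simp [sqrtX, Matrix.mul_apply, Complex.ext_iff] <;> norm_num
  · rintro P (rfl | rfl | rfl | rfl)
    · exact ⟨1, by simp, 1, by simp, by rw [one_smul]; exact sqrtX_conj _ _ (by simp)⟩
    · refine ⟨1, by simp, pauliX, by simp, sqrtX_conj _ _ ?_⟩
      ext i j; fin_cases i <;> fin_cases j <;> simp [sqrtX, Matrix.mul_apply, pauliX]
    · refine ⟨1, by simp, pauliZ, by simp, sqrtX_conj _ _ ?_⟩
      ext i j; fin_cases i <;> fin_cases j <;>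
        simp [sqrtX, Matrix.mul_apply, pauliY, pauliZ, Complex.ext_iff] <;> norm_num
    · refine ⟨-1, by simp, pauliY, by simp, sqrtX_conj _ _ ?_⟩
      ext i j; fin_cases i <;> fin_cases j <;>
        simp [sqrtX, Matrix.mul_apply, pauliY, pauliZ, Complex.ext_iff] <;> norm_num

/-- The controlled-`Z` gate. -/
def cz : Op 2 := Matrix.diagonal fun x => (-1) ^ ((x 0 : ℕ) * (x 1 : ℕ))

/-- Since CZ is diagonal, conjugation by it only multiplies each matrix entry by a sign. The claim
for one pair of Pauli matrices is therefore a check of 16 entries. -/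
theorem cz_conj_mem {P Q : Matrix (Fin 2) (Fin 2) ℂ} (α : ℂ) (P' Q' : Matrix (Fin 2) (Fin 2) ℂ)
    (hα : α ∈ ({1, -1, I, -I} : Set ℂ))
    (hP : P' ∈ ({1, pauliX, pauliY, pauliZ} : Set (Matrix (Fin 2) (Fin 2) ℂ)))
    (hQ : Q' ∈ ({1, pauliX, pauliY, pauliZ} : Set (Matrix (Fin 2) (Fin 2) ℂ)))
    (h : ∀ a b c d : Fin 2, (-1) ^ ((a : ℕ) * (b : ℕ)) * (P a c * Q b d) *
      (-1) ^ ((c : ℕ) * (d : ℕ)) = α * (P' a c * Q' b d))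
    (g : Fin 2 → Matrix (Fin 2) (Fin 2) ℂ) (h0 : g 0 = P) (h1 : g 1 = Q) :
    cz * tensor g * cz.conjTranspose ∈ pauliGroup 2 := by
  refine ⟨α, hα, ![P', Q'], fun j => ?_, ?_⟩
  · fin_cases j
    · exact hP
    · exact hQ
  · subst h0 h1
    ext x y
    have := h (x 0) (x 1) (y 0) (y 1)
    simpa [cz, tensor, Matrix.diagonal_conjTranspose, Fin.prod_univ_two, Pi.star_def] using this

theorem isClifford_cz : IsClifford cz := by
  refine isClifford_of_conj ?_ fun g hg => ?_
  · rw [cz, Matrix.diagonal_conjTranspose, Matrix.diagonal_mul_diagonal, ← Matrix.diagonal_one]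
    congr 1
    funext x
    simp [← pow_add, ← two_mul]
  · have h0 := hg 0
    have h1 := hg 1
    simp only [Set.mem_insert_iff, Set.mem_singleton_iff] at h0 h1
    rcases h0 with h0 | h0 | h0 | h0 <;> rcases h1 with h1 | h1 | h1 | h1
    · refine cz_conj_mem 1 1 1 (by simp) (by simp) (by simp) ?_ g h0 h1
      simp [Fin.forall_fin_two]
    · refine cz_conj_mem 1 pauliZ pauliX (by simp) (by simp) (by simp) ?_ g h0 h1
      simp [Fin.forall_fin_two, pauliX, pauliZ]
    · refine cz_conj_mem 1 pauliZ pauliY (by simp) (by simp) (by simp) ?_ g h0 h1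
      simp [Fin.forall_fin_two, pauliY, pauliZ]
    · refine cz_conj_mem 1 1 pauliZ (by simp) (by simp) (by simp) ?_ g h0 h1
      simp [Fin.forall_fin_two, pauliZ]
    · refine cz_conj_mem 1 pauliX pauliZ (by simp) (by simp) (by simp) ?_ g h0 h1
      simp [Fin.forall_fin_two, pauliX, pauliZ]
    · refine cz_conj_mem 1 pauliY pauliY (by simp) (by simp) (by simp) ?_ g h0 h1
      simp [Fin.forall_fin_two, pauliX, pauliY]
    · refine cz_conj_mem (-1) pauliY pauliX (by simp) (by simp) (by simp) ?_ g h0 h1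
      simp [Fin.forall_fin_two, pauliX, pauliY]
    · refine cz_conj_mem 1 pauliX 1 (by simp) (by simp) (by simp) ?_ g h0 h1
      simp [Fin.forall_fin_two, pauliX, pauliZ]
    · refine cz_conj_mem 1 pauliY pauliZ (by simp) (by simp) (by simp) ?_ g h0 h1
      simp [Fin.forall_fin_two, pauliY, pauliZ]
    · refine cz_conj_mem (-1) pauliX pauliY (by simp) (by simp) (by simp) ?_ g h0 h1
      simp [Fin.forall_fin_two, pauliX, pauliY]
    · refine cz_conj_mem 1 pauliX pauliX (by simp) (by simp) (by simp) ?_ g h0 h1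
      simp [Fin.forall_fin_two, pauliX, pauliY]
    · refine cz_conj_mem 1 pauliY 1 (by simp) (by simp) (by simp) ?_ g h0 h1
      simp [Fin.forall_fin_two, pauliY, pauliZ]
    · refine cz_conj_mem 1 pauliZ 1 (by simp) (by simp) (by simp) ?_ g h0 h1
      simp [Fin.forall_fin_two, pauliZ]
    · refine cz_conj_mem 1 1 pauliX (by simp) (by simp) (by simp) ?_ g h0 h1
      simp [Fin.forall_fin_two, pauliX, pauliZ]
    · refine cz_conj_mem 1 1 pauliY (by simp) (by simp) (by simp) ?_ g h0 h1
      simp [Fin.forall_fin_two, pauliY, pauliZ]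
    · refine cz_conj_mem 1 pauliZ pauliZ (by simp) (by simp) (by simp) ?_ g h0 h1
      simp [Fin.forall_fin_two, pauliZ]

/-! ## Transformations of states at bounded cost -/

/-- Flip one bit of a bit string. -/
def flip {N : ℕ} (v : Fin N) (x : Fin N → Fin 2) : Fin N → Fin 2 :=
  Function.update x v (x v + 1)

open Classical in
/-- The number of ones among the neighbours of `v`. -/
def nbrSum {N : ℕ} (G : SimpleGraph (Fin N)) (v : Fin N) (x : Fin N → Fin 2) : ℕ :=
  ∑ w ∈ Finset.univ.filter (G.Adj v), (x w : ℕ)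

theorem flip_same {N : ℕ} (v : Fin N) (x : Fin N → Fin 2) : flip v x v = x v + 1 := by
  simp [flip]

theorem flip_ne {N : ℕ} {v w : Fin N} (h : w ≠ v) (x : Fin N → Fin 2) : flip v x w = x w := by
  simp [flip, h]

theorem fin_two_add_one_add_one (b : Fin 2) : b + 1 + 1 = b := by
  revert b; decide

/-- Row `x` of the generator has a single nonzero entry, in the column `flip v x`: the factor `X`
flips the bit `v`, and the factors `Z` contribute the sign. -/
theorem graphStabilizer_mulVec {N : ℕ} (G : SimpleGraph (Fin N)) (v : Fin N) (ψ : State N)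
    (x : Fin N → Fin 2) :
    (graphStabilizer G v).mulVec ψ x = (-1) ^ nbrSum G v x * ψ (flip v x) := by
  classical
  rw [Matrix.mulVec, dotProduct, Finset.sum_eq_single (flip v x)]
  · congr 1
    rw [graphStabilizer, tensor, Matrix.of_apply, nbrSum, ← Finset.prod_pow_eq_pow_sum,
      Finset.prod_filter]
    refine Finset.prod_congr rfl fun w _ => ?_
    by_cases hw : w = v
    · subst hw
      rw [flip_same]
      generalize x w = b
      fin_cases b <;> simp [pauliX]
    · rw [flip_ne hw]
      simp only [hw, if_false]
      split_ifs
      · generalize x w = b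
        fin_cases b <;> simp [pauliZ]
      · simp
  · intro y _ hy
    obtain ⟨w, hw⟩ := Function.ne_iff.1 hy
    have : graphStabilizer G v x y = 0 := by
      rw [graphStabilizer, tensor, Matrix.of_apply]
      refine Finset.prod_eq_zero (Finset.mem_univ w) ?_
      by_cases hwv : w = v
      · subst hwv
        rw [flip_same] at hw
        revert hw
        generalize x w = b
        generalize y w = c
        fin_cases b <;> fin_cases c <;> simp [pauliX]
      · rw [flip_ne hwv] at hw
        simp only [hwv, if_false]
        split_ifs
        · revert hw
          generalize x w = b
          generalize y w = c
          fin_cases b <;> fin_cases c <;> simp [pauliZ]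
        · exact Matrix.one_apply_ne hw.symm
    rw [this, zero_mul]
  · simp

theorem neg_one_pow_mul_self (k : ℕ) : ((-1 : ℂ) ^ k) * (-1) ^ k = 1 := by
  rw [← pow_add, ← two_mul]; simp

theorem isGraphState_iff {N : ℕ} {G : SimpleGraph (Fin N)} {ψ : State N} :
    IsGraphState G ψ ↔ ψ ≠ 0 ∧ ∀ v x, ψ (flip v x) = (-1) ^ nbrSum G v x * ψ x := by
  refine and_congr_right fun _ => forall_congr' fun v => ?_
  rw [funext_iff]
  refine forall_congr' fun x => ?_
  rw [graphStabilizer_mulVec]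
  constructor <;> intro h
  · rw [← h, ← mul_assoc, neg_one_pow_mul_self, one_mul]
  · rw [h, ← mul_assoc, neg_one_pow_mul_self, one_mul]

/-- Every algorithm that starts in the state `φ` can be preceded by unitary operations, `k` of
them on two qubits, that transform `ψ` into `φ`. -/
def Reach {N : ℕ} (ψ φ : State N) (k : ℕ) : Prop :=
  ∀ (n : ℕ) (G : SimpleGraph (Fin n)) (A : QAlg n N), A.Generates G φ →
    ∃ B : QAlg n N, B.Generates G ψ ∧ B.cost = A.cost + k

theorem Reach.refl {N : ℕ} (ψ : State N) : Reach ψ ψ 0 := fun _ _ A h => ⟨A, h, rfl⟩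

theorem Reach.trans {N : ℕ} {ψ φ χ : State N} {k l : ℕ} (h : Reach ψ φ k) (h' : Reach φ χ l) :
    Reach ψ χ (k + l) := by
  intro n G A hA
  obtain ⟨B, hB, hc⟩ := h' n G A hA
  obtain ⟨C, hC, hc'⟩ := h n G B hB
  exact ⟨C, hC, by rw [hc', hc]; ring⟩

theorem extend_single {N : ℕ} (q : Fin 1 ↪ Fin N) (y : Fin 1 → Fin 2) (x : Fin N → Fin 2) :
    Function.extend q y x = Function.update x (q 0) (y 0) := by
  funext w
  by_cases hw : w = q 0
  · subst hw
    rw [q.injective.extend_apply, Function.update_self]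
  · rw [Function.update_of_ne hw, Function.extend_apply']
    rintro ⟨i, rfl⟩
    exact hw (by rw [Subsingleton.elim i 0])

theorem reach_single {N : ℕ} {u : Matrix (Fin 2) (Fin 2) ℂ} (hu : IsClifford (single u))
    (v : Fin N) (ψ : State N) :
    Reach ψ (fun x => u (x v) 0 * ψ (Function.update x v 0) +
      u (x v) 1 * ψ (Function.update x v 1)) 0 := by
  intro n G A hA
  let q : Fin 1 ↪ Fin N := ⟨fun _ => v, fun _ _ _ => Subsingleton.elim _ _⟩
  refine ⟨.gate₁ (single u) hu q A, ?_, rfl⟩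
  have : applyGate (single u) q ψ = (fun x => u (x v) 0 * ψ (Function.update x v 0) +
      u (x v) 1 * ψ (Function.update x v 1)) := by
    funext x
    rw [applyGate, ← (Equiv.funUnique (Fin 1) (Fin 2)).symm.sum_comp, Fin.sum_univ_two]
    simp only [extend_single]
    simp only [single, tensor, Matrix.of_apply, Fin.prod_univ_one]
    rfl
  rw [QAlg.Generates, this]
  exact hA

theorem update_of_apply_eq {N : ℕ} {x : Fin N → Fin 2} {v : Fin N} {b : Fin 2} (h : x v = b) :
    Function.update x v b = x := by
  rw [← h, Function.update_eq_self]

theorem reach_phase {N : ℕ} {ω : ℂ} (hω : ω ∈ ({1, -1, I, -I} : Set ℂ)) (v : Fin N)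
    (ψ : State N) : Reach ψ (fun x => ω ^ (x v : ℕ) * ψ x) 0 := by
  convert reach_single (isClifford_phaseGate hω) v ψ using 1
  funext x
  rcases Fin.exists_fin_two.1 ⟨x v, rfl⟩ with hx | hx
  · simp [phaseGate, hx, update_of_apply_eq hx]
  · simp [phaseGate, hx, update_of_apply_eq hx]

theorem reach_phases {N : ℕ} {ω : ℂ} (hω : ω ∈ ({1, -1, I, -I} : Set ℂ)) (T : Finset (Fin N))
    (ψ : State N) : Reach ψ (fun x => ω ^ (∑ w ∈ T, (x w : ℕ)) * ψ x) 0 := by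
  induction T using Finset.induction_on with
  | empty => simpa using Reach.refl ψ
  | insert v T hv ih =>
    convert ih.trans (reach_phase hω v _) using 1
    funext x
    rw [Finset.sum_insert hv, pow_add, mul_assoc]

theorem reach_cz {N : ℕ} {a b : Fin N} (hab : a ≠ b) (ψ : State N) :
    Reach ψ (fun x => (-1) ^ ((x a : ℕ) * (x b : ℕ)) * ψ x) 1 := by
  intro n G A hA
  have hq : Function.Injective ![a, b] := by
    intro i j hij
    fin_cases i <;> fin_cases j <;> simp_all [eq_comm]
  let q : Fin 2 ↪ Fin N := ⟨![a, b], hq⟩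
  refine ⟨.gate₂ cz isClifford_cz q A, ?_, rfl⟩
  have : applyGate cz q ψ = (fun x => (-1) ^ ((x a : ℕ) * (x b : ℕ)) * ψ x) := by
    funext x
    rw [applyGate, Finset.sum_eq_single (fun j => x (q j))]
    · have : Function.extend q (fun j => x (q j)) x = x := by
        funext w
        by_cases hw : ∃ i, q i = w
        · obtain ⟨i, rfl⟩ := hw
          rw [q.injective.extend_apply]
        · rw [Function.extend_apply' _ _ _ hw]
      rw [this]
      simp [cz, q]
    · intro y _ hy
      rw [cz, Matrix.diagonal_apply_ne _ hy.symm, zero_mul]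
    · simp
  rw [QAlg.Generates, this]
  exact hA

theorem reach_sqrtX {N : ℕ} (v : Fin N) (ψ : State N) :
    Reach ψ (fun x => (1 + I) / 2 * ψ x + (1 - I) / 2 * ψ (flip v x)) 0 := by
  convert reach_single isClifford_sqrtX v ψ using 1
  funext x
  rw [flip]
  rcases Fin.exists_fin_two.1 ⟨x v, rfl⟩ with hx | hx
  · simp [sqrtX, hx, update_of_apply_eq hx]
  · simp [sqrtX, hx, update_of_apply_eq hx, add_comm]

/-- The gates `sqrtX` and `diag(1, i)` take `|0⟩` to `(1 + i)/2 · (|0⟩ + |1⟩)`. Treating all qubits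
in this way gives the uniform superposition; `T` below is the set of qubits already treated. -/
theorem reach_edgeless (N : ℕ) : ∃ φ, IsGraphState (⊥ : SimpleGraph (Fin N)) φ ∧
    Reach (zeroState N) φ 0 := by
  have key : ∀ T : Finset (Fin N), ∃ φ : State N, Reach (zeroState N) φ 0 ∧ φ 0 ≠ 0 ∧
      (∀ v ∈ T, ∀ x, φ (flip v x) = φ x) ∧ ∀ x, (∃ v ∉ T, x v ≠ 0) → φ x = 0 := by
    intro T
    induction T using Finset.induction_on with
    | empty =>
      refine ⟨zeroState N, Reach.refl _, by simp [zeroState], by simp, ?_⟩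
      rintro x ⟨v, -, hv⟩
      exact Pi.single_eq_of_ne (fun h => hv (by rw [h]; rfl)) _
    | insert v T hv ih =>
      obtain ⟨φ, hr, h0, hT, hz⟩ := ih
      have hI : (I : ℂ) ∈ ({1, -1, I, -I} : Set ℂ) := by simp
      have hfl : ∀ x : Fin N → Fin 2, x v = 1 → φ x = 0 := fun x hx => hz x ⟨v, hv, by simp [hx]⟩
      refine ⟨_, (hr.trans (reach_sqrtX v φ)).trans (reach_phase hI v _), ?_, ?_, ?_⟩
      · rw [hfl (flip v 0) (by simp [flip_same])]
        have : (1 : ℂ) + I ≠ 0 := fun h => by simpa using congrArg Complex.re h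
        simp [h0, this]
      · intro w hw x
        rcases Finset.mem_insert.1 hw with rfl | hw
        · have hff : flip w (flip w x) = x := by
            simp [flip, fin_two_add_one_add_one]
          simp only [hff, flip_same]
          rcases Fin.exists_fin_two.1 ⟨x w, rfl⟩ with hx | hx
          · rw [hfl (flip w x) (by rw [flip_same, hx]; rfl), hx]
            simp only [zero_add, Fin.val_zero, Fin.val_one, mul_zero, add_zero, pow_one, pow_zero]
            linear_combination (-φ x / 2) * I_sq
          · rw [hfl x hx, hx]
            simp only [Fin.val_zero, Fin.val_one, mul_zero, zero_add, pow_one,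
              show (1 + 1 : Fin 2) = 0 from rfl, pow_zero]
            linear_combination (φ (flip w x) / 2) * I_sq
        · have hvw : v ≠ w := fun h => hv (h ▸ hw)
          have hc : flip v (flip w x) = flip w (flip v x) := by
            simp [flip, hvw, hvw.symm, Function.update_comm hvw]
          simp only [hc, hT w hw, flip_ne hvw]
      · rintro x ⟨w, hw, hx⟩
        simp only [Finset.mem_insert, not_or] at hw
        rw [hz x ⟨w, hw.2, hx⟩, hz (flip v x) ⟨w, hw.2, by rwa [flip_ne hw.1]⟩]
        simp
  obtain ⟨φ, hr, h0, hT, -⟩ := key Finset.univ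
  refine ⟨φ, isGraphState_iff.2 ⟨fun h => h0 (by rw [h]; rfl), fun v x => ?_⟩, hr⟩
  rw [hT v (Finset.mem_univ v)]
  simp [nbrSum]

/-! ## Graph operations on graph states -/

theorem nbrSum_flip_of_not_adj {N : ℕ} {G : SimpleGraph (Fin N)} {u v : Fin N} (h : ¬ G.Adj v u)
    (x : Fin N → Fin 2) : nbrSum G v (flip u x) = nbrSum G v x := by
  classical
  refine Finset.sum_congr rfl fun w hw => ?_
  rw [flip_ne]
  rintro rfl
  exact h (Finset.mem_filter.1 hw).2

theorem neg_one_pow_eq_of_xor {N : ℕ} {G H : SimpleGraph (Fin N)} {u : Fin N}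
    {T : Finset (Fin N)} (h : ∀ w, H.Adj u w ↔ Xor (G.Adj u w) (w ∈ T)) (x : Fin N → Fin 2) :
    (-1 : ℂ) ^ nbrSum H u x = (-1) ^ nbrSum G u x * (-1) ^ ∑ w ∈ T, (x w : ℕ) := by
  classical
  have hT : T = Finset.univ.filter (· ∈ T) := by simp
  rw [hT, nbrSum, nbrSum]
  simp only [← Finset.prod_pow_eq_pow_sum, Finset.prod_filter]
  rw [← Finset.prod_mul_distrib]
  refine Finset.prod_congr rfl fun w _ => ?_
  by_cases h1 : G.Adj u w <;> by_cases h2 : w ∈ T <;> simp [h, h1, h2, Xor, neg_one_pow_mul_self]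

/-- The scalar by which the local complementation at `v` multiplies an amplitude with `s` ones
among the neighbours of `v`. -/
def localScalar (s : ℕ) : ℂ := (-I) ^ s * ((1 + I) / 2 + (1 - I) / 2 * (-1) ^ s)

/-- Since `localScalar 0 = 1`, this recursion says that `localScalar s` is -1 to the power
`s(s-1)/2`: one sign for each pair of neighbours whose bits are both one, as if a CZ gate acted on
every pair of neighbours. -/
theorem localScalar_succ (s : ℕ) : localScalar (s + 1) = (-1) ^ s * localScalar s := by
  rw [localScalar, localScalar, pow_succ, pow_succ]
  rcases neg_one_pow_eq_or ℂ s with h | h <;> rw [h]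
  · linear_combination (-(-I) ^ s) * I_sq
  · linear_combination (0 : ℂ) * I_sq

theorem localScalar_ne_zero (s : ℕ) : localScalar s ≠ 0 := by
  induction s with
  | zero => simp [localScalar, ← add_div]
  | succ s ih => rw [localScalar_succ]; exact mul_ne_zero (pow_ne_zero _ (by norm_num)) ih

/-- The state obtained from `ψ` by the gates of the local complementation at `v`. -/
def localState {N : ℕ} (G : SimpleGraph (Fin N)) (v : Fin N) (ψ : State N) : State N :=
  fun x => localScalar (nbrSum G v x) * ψ x

theorem State.mul_ne_zero {N : ℕ} {f ψ : State N} (hψ : ψ ≠ 0) (hf : ∀ x, f x ≠ 0) :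
    (fun x => f x * ψ x) ≠ 0 := by
  obtain ⟨x, hx⟩ := Function.ne_iff.1 hψ
  exact Function.ne_iff.2 ⟨x, _root_.mul_ne_zero (hf x) hx⟩

theorem IsGraphState.localCompl {N : ℕ} {G : SimpleGraph (Fin N)} {ψ : State N}
    (h : IsGraphState G ψ) (v : Fin N) :
    IsGraphState (localCompl v G) (localState G v ψ) := by
  classical
  rw [isGraphState_iff] at h ⊢
  refine ⟨State.mul_ne_zero h.1 fun x => localScalar_ne_zero _, fun u x => ?_⟩
  rw [localState, localState, h.2]
  by_cases huv : G.Adj v u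
  · have hT : ∀ w, (GraphPrep.localCompl v G).Adj u w ↔
        Xor (G.Adj u w) (w ∈ (Finset.univ.filter (G.Adj v)).erase u) := by
      intro w
      by_cases hw : u = w
      · subst hw; simp [Xor]
      · have hw' : ¬ w = u := fun e => hw e.symm
        simp [GraphPrep.localCompl, hw, hw', huv]
    rw [neg_one_pow_eq_of_xor hT]
    have hs : ∀ y : Fin N → Fin 2, nbrSum G v y =
        ∑ w ∈ (Finset.univ.filter (G.Adj v)).erase u, (y w : ℕ) + (y u : ℕ) := fun y =>
      (Finset.sum_erase_add _ _ (by simpa using huv)).symm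
    have ht : ∑ w ∈ (Finset.univ.filter (G.Adj v)).erase u, (flip u x w : ℕ) =
        ∑ w ∈ (Finset.univ.filter (G.Adj v)).erase u, (x w : ℕ) :=
      Finset.sum_congr rfl fun w hw => by rw [flip_ne (Finset.ne_of_mem_erase hw)]
    rw [hs, hs, ht, flip_same]
    generalize ∑ w ∈ (Finset.univ.filter (G.Adj v)).erase u, (x w : ℕ) = t
    -- Flipping the bit of the neighbour `u` changes the number of ones from `t` to `t + 1` or back;
    -- in both directions the scalar changes by the sign of the other neighbours.
    have key : localScalar (t + ((x u + 1 : Fin 2) : ℕ)) =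
        (-1) ^ t * localScalar (t + (x u : ℕ)) := by
      rcases Fin.exists_fin_two.1 ⟨x u, rfl⟩ with hx | hx
      · rw [hx]; exact localScalar_succ t
      · rw [hx, show ((1 + 1 : Fin 2) : ℕ) = 0 from rfl, show ((1 : Fin 2) : ℕ) = 1 from rfl,
          localScalar_succ, ← mul_assoc, neg_one_pow_mul_self, one_mul, add_zero]
    rw [key]
    ring
  · have hT : ∀ w, (GraphPrep.localCompl v G).Adj u w ↔
        Xor (G.Adj u w) (w ∈ (∅ : Finset (Fin N))) := by
      intro w
      by_cases hw : u = w
      · subst hw; simp [Xor]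
      · simp [GraphPrep.localCompl, hw, huv, Xor]
    rw [neg_one_pow_eq_of_xor hT, nbrSum_flip_of_not_adj huv]
    simp only [Finset.sum_empty, pow_zero]
    ring

/-- On a graph state, the flip of bit `v` inside `sqrtX` becomes a sign. The gate thus acts
diagonally, and the phases `-i` on the neighbours complete it to `localScalar`. -/
theorem IsGraphState.reach_localCompl {N : ℕ} {G : SimpleGraph (Fin N)} {ψ : State N}
    (h : IsGraphState G ψ) (v : Fin N) : Reach ψ (localState G v ψ) 0 := by
  classical
  convert (reach_sqrtX v ψ).trans
    (reach_phases (ω := -I) (by simp) (Finset.univ.filter (G.Adj v)) _) using 1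
  funext x
  rw [(isGraphState_iff.1 h).2, localState, localScalar, nbrSum]
  ring

theorem IsGraphState.edgeCompl {N : ℕ} {G : SimpleGraph (Fin N)} {ψ : State N}
    (h : IsGraphState G ψ) {a b : Fin N} (hab : a ≠ b) :
    IsGraphState (edgeCompl a b G) (fun x => (-1) ^ ((x a : ℕ) * (x b : ℕ)) * ψ x) := by
  classical
  rw [isGraphState_iff] at h ⊢
  refine ⟨State.mul_ne_zero h.1 fun x => pow_ne_zero _ (by norm_num), fun u x => ?_⟩
  have hxor : ∀ (T : Finset (Fin N)), (∀ w, w ∈ T ↔ s(u, w) = s(a, b)) →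
      ∀ w, (GraphPrep.edgeCompl a b G).Adj u w ↔ Xor (G.Adj u w) (w ∈ T) := by
    intro T hT w
    rw [hT]
    by_cases hw : u = w
    · subst hw
      have : s(u, u) ≠ s(a, b) := by
        rw [Ne, Sym2.eq_iff]
        rintro (⟨rfl, rfl⟩ | ⟨rfl, rfl⟩) <;> exact hab rfl
      simp [Xor, this]
    · simp [GraphPrep.edgeCompl, hw]
  have hflip : ∀ c : Fin N, (-1 : ℂ) ^ (((x c + 1 : Fin 2)) : ℕ) = - (-1) ^ (x c : ℕ) := by
    intro c
    generalize x c = d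
    fin_cases d <;> simp
  have hone : ∀ k : ℕ, ∀ d : Fin 2, (-1 : ℂ) ^ (((d + 1 : Fin 2) : ℕ) * k) =
      (-1) ^ k * (-1) ^ ((d : ℕ) * k) := by
    intro k d
    fin_cases d <;> simp [neg_one_pow_mul_self]
  rw [h.2]
  by_cases hua : u = a
  · subst hua
    rw [neg_one_pow_eq_of_xor (hxor {b} fun w => by
      simp only [Finset.mem_singleton, Sym2.eq_iff]
      constructor
      · rintro rfl; simp
      · rintro (⟨-, rfl⟩ | ⟨e, -⟩)
        · rfl
        · exact absurd e hab), Finset.sum_singleton, flip_same, flip_ne hab.symm, hone]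
    ring
  by_cases hub : u = b
  · subst hub
    rw [neg_one_pow_eq_of_xor (hxor {a} fun w => by
      simp only [Finset.mem_singleton, Sym2.eq_iff]
      constructor
      · rintro rfl; simp
      · rintro (⟨e, -⟩ | ⟨-, rfl⟩)
        · exact absurd e hua
        · rfl), Finset.sum_singleton, flip_same, flip_ne hab, mul_comm (x a : ℕ),
      mul_comm (x a : ℕ), hone]
    ring
  · rw [neg_one_pow_eq_of_xor (hxor ∅ fun w => by
      simp only [Finset.notMem_empty, Sym2.eq_iff, false_iff]
      rintro (⟨e, -⟩ | ⟨e, -⟩)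
      · exact hua e
      · exact hub e), flip_ne (Ne.symm hua), flip_ne (Ne.symm hub)]
    simp only [Finset.sum_empty, pow_zero]
    ring

theorem edgeCompl_self {V : Type*} (a : V) (G : SimpleGraph V) : edgeCompl a a G = G := by
  ext u w
  simp only [edgeCompl, Sym2.eq_iff]
  constructor
  · rintro ⟨hn, (⟨h, -⟩ | ⟨(⟨rfl, rfl⟩ | ⟨rfl, rfl⟩), -⟩)⟩
    · exact h
    · exact absurd rfl hn
    · exact absurd rfl hn
  · intro h
    refine ⟨G.ne_of_adj h, Or.inl ⟨h, ?_⟩⟩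
    rintro (⟨rfl, rfl⟩ | ⟨rfl, rfl⟩) <;> exact G.ne_of_adj h rfl

theorem localCompl_comap {V W : Type*} (e : W ≃ V) (v : V) (G : SimpleGraph V) :
    (localCompl v G).comap e = localCompl (e.symm v) (G.comap e) := by
  ext u w
  simp [localCompl]

theorem edgeCompl_comap {V W : Type*} (e : W ≃ V) (a b : V) (G : SimpleGraph V) :
    (edgeCompl a b G).comap e = edgeCompl (e.symm a) (e.symm b) (G.comap e) := by
  ext u w
  simp [edgeCompl, Equiv.eq_symm_apply]

/-- A sequence of graph operations is realized by unitary operations of at most the same cost. -/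
theorem reach_runOps {V : Type*} {N : ℕ} (e : Fin N ≃ V) (ops : List (GraphOp V)) :
    ∃ φ, IsGraphState ((runOps ops).comap e) φ ∧
      ∃ k ≤ costOps ops, Reach (zeroState N) φ k := by
  induction ops using List.reverseRecOn with
  | nil =>
    obtain ⟨φ, h, hr⟩ := reach_edgeless N
    exact ⟨φ, by simpa [runOps] using h, 0, le_rfl, hr⟩
  | append_singleton ops op ih =>
    obtain ⟨φ, h, k, hk, hr⟩ := ih
    have hrun : runOps (ops ++ [op]) = op.apply (runOps ops) := by simp [runOps]
    have hcost : costOps (ops ++ [op]) = costOps ops + op.cost := by simp [costOps]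
    rw [hrun, hcost]
    cases op with
    | localCompl v =>
      refine ⟨_, ?_, k + 0, by simpa [GraphOp.cost] using hk, hr.trans (h.reach_localCompl (e.symm v))⟩
      rw [GraphOp.apply, localCompl_comap]
      exact h.localCompl _
    | edgeCompl a b =>
      -- The type of operations allows `edgeCompl a a`, which changes nothing and needs no gate.
      -- This is why the number of gates is only bounded by the cost.
      by_cases hab : a = b
      · subst hab
        exact ⟨φ, by rwa [GraphOp.apply, edgeCompl_self], k, by omega, hr⟩
      · have hab' : e.symm a ≠ e.symm b := fun h => hab (e.symm.injective h)
        refine ⟨_, ?_, k + 1, by simpa [GraphOp.cost] using hk, hr.trans (reach_cz hab' φ)⟩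
        rw [GraphOp.apply, edgeCompl_comap]
        exact h.edgeCompl hab'

/-! ## The CZ-complexity of graphs generated by graph operations -/

theorem czComplexity_le {n s : ℕ} {G : SimpleGraph (Fin n)} {A : QAlg n (n + s)}
    (h : A.Generates G (zeroState (n + s))) : czComplexity G ≤ A.cost :=
  iInf_le_of_le s (iInf₂_le A h)

theorem czComplexity_runOps_le {n : ℕ} (ops : List (GraphOp (Fin n))) :
    czComplexity (runOps ops) ≤ (costOps ops : ℕ∞) := by
  obtain ⟨φ, h, k, hk, hr⟩ := reach_runOps (Equiv.refl _) ops
  obtain ⟨B, hB, hc⟩ := hr n (runOps ops) .done h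
  refine (czComplexity_le (s := 0) hB).trans ?_
  rw [hc]
  simpa [QAlg.cost] using hk

/-- Measuring a qubit of a graph state gives, up to phase gates, the graph state of the graph
without the vertex. -/
theorem IsGraphState.postMeasure {n : ℕ} {G : SimpleGraph (Fin (n + 1))} {ψ : State (n + 1)}
    (h : IsGraphState G ψ) (b : Fin 2) (hb : postMeasure 0 b ψ ≠ 0) :
    ∃ φ, Reach (postMeasure 0 b ψ) φ 0 ∧ IsGraphState (G.comap Fin.succ) φ := by
  classical
  -- Outcome 1 leaves a factor -1 for each one among the neighbours of the measured vertex; `Z`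
  -- gates on these neighbours remove it.
  let T : Finset (Fin n) := if b = 0 then ∅ else Finset.univ.filter fun w => G.Adj 0 w.succ
  refine ⟨_, reach_phases (ω := -1) (by simp) T _, ?_⟩
  rw [isGraphState_iff] at h ⊢
  refine ⟨State.mul_ne_zero hb fun x => pow_ne_zero _ (by norm_num), fun v x => ?_⟩
  have hflip : ∀ x : Fin n → Fin 2, GraphPrep.postMeasure 0 b ψ x = ψ (Fin.cons b x) := by
    intro x
    rw [GraphPrep.postMeasure, Fin.insertNth_zero']
  have hc : (Fin.cons b (flip v x) : Fin (n + 1) → Fin 2) = flip v.succ (Fin.cons b x) := by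
    rw [flip, flip, Fin.cons_update, Fin.cons_succ]
  have hsum : nbrSum G v.succ (Fin.cons b x) =
      (if G.Adj v.succ 0 then (b : ℕ) else 0) + nbrSum (G.comap Fin.succ) v x := by
    rw [nbrSum, nbrSum, Finset.sum_filter, Finset.sum_filter, Fin.sum_univ_succ]
    simp
  have hT : (-1 : ℂ) ^ ∑ w ∈ T, (flip v x w : ℕ) =
      (-1) ^ (if G.Adj v.succ 0 then (b : ℕ) else 0) * (-1) ^ ∑ w ∈ T, (x w : ℕ) := by
    have hx : (-1 : ℂ) ^ ((x v + 1 : Fin 2) : ℕ) = (-1) * (-1) ^ (x v : ℕ) := by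
      generalize x v = d
      fin_cases d <;> simp
    by_cases hv : v ∈ T
    · rw [← Finset.add_sum_erase _ _ hv, ← Finset.add_sum_erase _ _ hv, pow_add, pow_add,
        flip_same, hx]
      have hb1 : b = 1 := by
        by_contra hb1
        have : b = 0 := by omega
        simp [T, this] at hv
      have hadj : G.Adj v.succ 0 := by
        simp [T, hb1] at hv
        exact hv.symm
      rw [Finset.sum_congr rfl fun w hw => by rw [flip_ne (Finset.ne_of_mem_erase hw)]]
      simp [hb1, hadj]
    · rw [Finset.sum_congr rfl fun w hw => by rw [flip_ne (fun e : w = v => hv (e ▸ hw))]]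
      have : (if G.Adj v.succ 0 then (b : ℕ) else 0) = 0 := by
        by_cases hb0 : b = 0
        · simp [hb0]
        · rw [if_neg]
          intro hadj
          exact hv (by simp [T, hb0, hadj.symm])
      rw [this, pow_zero, one_mul]
  rw [hflip, hflip, hc, h.2, hsum, hT, pow_add]
  linear_combination ((-1) ^ (∑ w ∈ T, (x w : ℕ)) * (-1) ^ nbrSum (G.comap Fin.succ) v x *
    ψ (Fin.cons b x)) * neg_one_pow_mul_self (if G.Adj v.succ 0 then (b : ℕ) else 0)

theorem exists_alg_of_runOps {n : ℕ} (ops : List (GraphOp (Option (Fin n)))) :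
    ∃ A : QAlg n (n + 1), A.Generates ((runOps ops).comap some) (zeroState (n + 1)) ∧
      A.cost ≤ costOps ops := by
  obtain ⟨φ, h, k, hk, hr⟩ := reach_runOps (finSuccEquiv n) ops
  have hG : ((runOps ops).comap (finSuccEquiv n)).comap Fin.succ = (runOps ops).comap some := by
    ext u w
    simp
  have hA : ∀ b, ∃ A : QAlg n n, (postMeasure 0 b φ ≠ 0 →
      A.Generates ((runOps ops).comap some) (postMeasure 0 b φ)) ∧ A.cost = 0 := by
    intro b
    by_cases hb : postMeasure 0 b φ = 0
    -- An outcome of probability zero imposes no condition, so any continuation of cost zero will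
    -- do.
    · exact ⟨.done, fun h => absurd hb h, rfl⟩
    · obtain ⟨χ, hr', hχ⟩ := h.postMeasure b hb
      rw [hG] at hχ
      obtain ⟨A, hA, hc⟩ := hr' n _ .done hχ
      exact ⟨A, fun _ => hA, by simpa [QAlg.cost] using hc⟩
  choose A hA hc using hA
  obtain ⟨B, hB, hcB⟩ := hr n ((runOps ops).comap some) (.measure 0 A) hA
  refine ⟨B, hB, ?_⟩
  rw [hcB, QAlg.cost, hc, hc]
  simpa using hk

/-! ## Double occurrence words -/

section Words

variable {V : Type*} [DecidableEq V]

/-- Every letter appears twice or not at all. -/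
def IsPartialWord (m : List V) : Prop := ∀ a, m.count a = 0 ∨ m.count a = 2

theorem IsDoubleOccurrence.isPartialWord {m : List V} (h : IsDoubleOccurrence m) :
    IsPartialWord m := fun a => Or.inr (h a)

theorem IsDoubleOccurrence.length {n : ℕ} {m : List (Fin n)} (h : IsDoubleOccurrence m) :
    m.length = 2 * n := by
  rw [← List.sum_toFinset_count_eq_length]
  have : m.toFinset = Finset.univ := by
    ext a
    simp [← List.count_pos_iff, h a]
  rw [this, Finset.sum_congr rfl fun a _ => h a]
  simp [mul_comm]

theorem count_subword_left (m : List V) (a b : V) : (subword m a b).count a = m.count a := by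
  rw [subword, List.count_filter]; simp

theorem count_subword_right (m : List V) (a b : V) : (subword m a b).count b = m.count b := by
  rw [subword, List.count_filter]; simp

theorem mem_subword {m : List V} {a b x : V} (h : x ∈ subword m a b) : x = a ∨ x = b := by
  simpa [subword] using (List.mem_filter.1 h).2

theorem two_letter_cases {l : List V} {a b : V} (hab : a ≠ b) (hl : ∀ x ∈ l, x = a ∨ x = b)
    (ha : l.count a = 2) (hb : l.count b = 2) :
    l = [a, a, b, b] ∨ l = [a, b, a, b] ∨ l = [a, b, b, a] ∨
      l = [b, a, a, b] ∨ l = [b, a, b, a] ∨ l = [b, b, a, a] := by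
  have hba : b ≠ a := hab.symm
  have hlen : l.length = 4 := by
    rw [← List.sum_toFinset_count_eq_length]
    have : l.toFinset = {a, b} := by
      ext x
      constructor
      · intro h; simpa using hl x (by simpa using h)
      · intro h
        rcases (by simpa using h : x = a ∨ x = b) with rfl | rfl <;>
          simp [← List.count_pos_iff, ha, hb]
    rw [this, Finset.sum_pair hab, ha, hb]
  obtain ⟨x, y, z, w, rfl⟩ : ∃ x y z w, l = [x, y, z, w] := by
    match l, hlen with
    | [x, y, z, w], _ => exact ⟨x, y, z, w, rfl⟩
  simp only [List.mem_cons, List.not_mem_nil, or_false, forall_eq_or_imp, forall_eq] at hl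
  obtain ⟨hx, hy, hz, hw⟩ := hl
  rcases hx with rfl | rfl <;> rcases hy with rfl | rfl <;> rcases hz with rfl | rfl <;>
    rcases hw with rfl | rfl <;> simp_all

theorem subword_cases {m : List V} {a b : V} (hab : a ≠ b) (ha : m.count a = 2)
    (hb : m.count b = 2) :
    subword m a b = [a, a, b, b] ∨ subword m a b = [a, b, a, b] ∨ subword m a b = [a, b, b, a] ∨
      subword m a b = [b, a, a, b] ∨ subword m a b = [b, a, b, a] ∨
      subword m a b = [b, b, a, a] :=
  two_letter_cases hab (fun _ h => mem_subword h) (by rw [count_subword_left, ha])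
    (by rw [count_subword_right, hb])

/-- Two letters are adjacent in the interval graph iff some prefix contains exactly one occurrence
of both. -/
theorem intervalGraph_adj_iff {m : List V} {a b : V} (hab : a ≠ b) (ha : m.count a = 2)
    (hb : m.count b = 2) :
    (intervalGraph m).Adj a b ↔ ∃ q, q <+: m ∧ q.count a = 1 ∧ q.count b = 1 := by
  have hba := hab.symm
  -- Prefixes of a filtered word are the filtered prefixes, so only the six possible subwords on two
  -- letters have to be inspected.
  have key : (∃ q, q <+: m ∧ q.count a = 1 ∧ q.count b = 1) ↔
      ∃ q, q <+: subword m a b ∧ q.count a = 1 ∧ q.count b = 1 := by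
    constructor
    · rintro ⟨q, hq, h1, h2⟩
      exact ⟨subword q a b, hq.filter _, by rw [count_subword_left, h1],
        by rw [count_subword_right, h2]⟩
    · rintro ⟨q, hq, h1, h2⟩
      obtain ⟨q', hq', rfl⟩ := List.prefix_filter_iff.1 hq
      exact ⟨q', hq', by rw [← h1]; exact (count_subword_left _ _ _).symm,
        by rw [← h2]; exact (count_subword_right _ _ _).symm⟩
  rw [key]
  simp only [intervalGraph, Nested, Alternating, hab, ne_eq, not_false_eq_true, true_and]
  rcases subword_cases hab ha hb with h | h | h | h | h | h <;> rw [h] <;>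
    simp [List.prefix_cons_iff, hab, hba]

end Words

/-! ## The algorithm for interval graphs -/

section Interval

variable {V : Type*} [DecidableEq V]

/-- The graph on the letters and the auxiliary vertex after the prefix `p` has been read. -/
structure IsPrefixGraph (p : List V) (G : SimpleGraph (Option V)) : Prop where
  none_adj : ∀ a, G.Adj none (some a) ↔ p.count a = 1
  some_adj : ∀ a b, G.Adj (some a) (some b) ↔
    a ≠ b ∧ ∃ q, q <+: p ∧ q.count a = 1 ∧ q.count b = 1

theorem isPrefixGraph_nil : IsPrefixGraph ([] : List V) ⊥ where
  none_adj a := by simp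
  some_adj a b := by simp

theorem exists_prefix_concat_iff {W : Type*} {p : List W} {c : W} {P : List W → Prop} :
    (∃ q, q <+: p ++ [c] ∧ P q) ↔ (∃ q, q <+: p ∧ P q) ∨ P (p ++ [c]) := by
  simp only [List.prefix_concat_iff]
  constructor
  · rintro ⟨q, rfl | hq, h⟩
    · exact Or.inr h
    · exact Or.inl ⟨q, hq, h⟩
  · rintro (⟨q, hq, h⟩ | h)
    · exact ⟨q, Or.inr hq, h⟩
    · exact ⟨_, Or.inl rfl, h⟩

/-- The first local complementation acts on the pairs of open letters, the second on the pairs of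
open letters together with `c`. Their composition toggles exactly the pairs of `c` with an open
letter, and `c` had no neighbour before. -/
theorem IsPrefixGraph.first {p : List V} {G : SimpleGraph (Option V)} (h : IsPrefixGraph p G)
    {c : V} (hc : c ∉ p) :
    IsPrefixGraph (p ++ [c]) (localCompl none (edgeCompl (some c) none (localCompl none G))) := by
  have hc0 : p.count c = 0 := List.count_eq_zero.2 hc
  have hq0 : ∀ q, q <+: p → q.count c = 0 := fun q hq =>
    List.count_eq_zero.2 fun hm => hc (hq.subset hm)
  have hN : ∀ a, (edgeCompl (some c) none (localCompl none G)).Adj none (some a) ↔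
      (p ++ [c]).count a = 1 := by
    intro a
    by_cases hac : a = c
    · subst hac; simp [edgeCompl, localCompl, h.none_adj, hc0]
    · have hca : ¬ c = a := fun e => hac e.symm
      simp [edgeCompl, localCompl, h.none_adj, hac, hca, Xor]
  refine ⟨fun a => ?_, fun a b => ?_⟩
  · rw [← hN a]
    simp [localCompl, Xor]
  · by_cases hab : a = b
    · subst hab; simp
    have hE : (edgeCompl (some c) none (localCompl none G)).Adj (some a) (some b) ↔
        Xor (G.Adj (some a) (some b)) (p.count a = 1 ∧ p.count b = 1) := by
      simp [edgeCompl, localCompl, hab, Xor, h.none_adj]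
    have hL : (localCompl none (edgeCompl (some c) none (localCompl none G))).Adj (some a)
        (some b) ↔ Xor (Xor (G.Adj (some a) (some b)) (p.count a = 1 ∧ p.count b = 1))
          ((p ++ [c]).count a = 1 ∧ (p ++ [c]).count b = 1) := by
      rw [← hE, ← hN, ← hN]
      simp [localCompl, hab]
    rw [hL, exists_prefix_concat_iff, h.some_adj]
    simp only [hab, ne_eq, not_false_eq_true, true_and]
    by_cases hac : a = c
    · subst hac
      have : ¬ ∃ q, q <+: p ∧ q.count a = 1 ∧ q.count b = 1 := by
        rintro ⟨q, hq, h1, -⟩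
        rw [hq0 q hq] at h1
        omega
      simp [this, hc0, Xor]
    by_cases hbc : b = c
    · subst hbc
      have : ¬ ∃ q, q <+: p ∧ q.count a = 1 ∧ q.count b = 1 := by
        rintro ⟨q, hq, -, h1⟩
        rw [hq0 q hq] at h1
        omega
      simp [this, hc0, Xor]
    have hca : ¬ c = a := fun e => hac e.symm
    have hcb : ¬ c = b := fun e => hbc e.symm
    have hp : p.count a = 1 ∧ p.count b = 1 → ∃ q, q <+: p ∧ q.count a = 1 ∧ q.count b = 1 :=
      fun h => ⟨p, List.prefix_rfl, h⟩
    simp only [List.count_append, List.count_singleton, beq_iff_eq, hca, hcb, if_false, add_zero]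
    generalize (∃ q, q <+: p ∧ q.count a = 1 ∧ q.count b = 1) = A at hp ⊢
    generalize (p.count a = 1 ∧ p.count b = 1) = B at hp ⊢
    by_cases hA : A <;> by_cases hB : B <;> simp_all [Xor]

/-- Closing `c` detaches it from the auxiliary vertex and creates no edge: two letters that are both
open after `c` differ from `c`, so they were both open before. -/
theorem IsPrefixGraph.second {p : List V} {G : SimpleGraph (Option V)} (h : IsPrefixGraph p G)
    {c : V} (hc : p.count c = 1) :
    IsPrefixGraph (p ++ [c]) (edgeCompl (some c) none G) where
  none_adj a := by
    by_cases hac : a = c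
    · subst hac; simp [edgeCompl, h.none_adj, hc]
    · have hca : ¬ c = a := fun e => hac e.symm
      simp [edgeCompl, h.none_adj, hac, hca, Xor]
  some_adj a b := by
    have hE : (edgeCompl (some c) none G).Adj (some a) (some b) ↔ G.Adj (some a) (some b) := by
      by_cases hab : a = b
      · subst hab; simp
      · simp [edgeCompl, hab, Xor]
    rw [hE, h.some_adj, exists_prefix_concat_iff]
    refine and_congr_right fun hab => ⟨Or.inl, ?_⟩
    rintro (h1 | ⟨h1, h2⟩)
    · exact h1
    · refine ⟨p, List.prefix_rfl, ?_⟩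
      rw [List.count_append, List.count_singleton] at h1 h2
      have hac : c ≠ a := by rintro rfl; simp at h1; omega
      have hbc : c ≠ b := by rintro rfl; simp at h2; omega
      simpa [hac, hbc] using And.intro h1 h2

theorem intervalOps_take {m : List V} (hm : IsDoubleOccurrence m) (j : ℕ) (hj : j ≤ m.length) :
    IsPrefixGraph (m.take j) (runOps (((m.take j).zipIdx).flatMap
      fun p => letterOps (p.1 ∉ m.take p.2) p.1)) ∧
    costOps (((m.take j).zipIdx).flatMap fun p => letterOps (p.1 ∉ m.take p.2) p.1) = j := by
  induction j with
  | zero => simpa [runOps, costOps] using isPrefixGraph_nil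
  | succ j ih =>
    obtain ⟨ih, ihc⟩ := ih (by omega)
    have hlt : j < m.length := by omega
    have htake : m.take (j + 1) = m.take j ++ [m[j]] := by simp
    have hz : ((m.take (j + 1)).zipIdx).flatMap
        (fun p => letterOps (p.1 ∉ m.take p.2) p.1) =
        ((m.take j).zipIdx).flatMap (fun p => letterOps (p.1 ∉ m.take p.2) p.1) ++
          letterOps (m[j] ∉ m.take j) m[j] := by
      rw [htake, List.zipIdx_append, List.flatMap_append]
      simp [Nat.min_eq_left hlt.le]
    rw [hz]
    set L := ((m.take j).zipIdx).flatMap (fun p => letterOps (p.1 ∉ m.take p.2) p.1)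
    constructor
    · rw [runOps, List.foldl_append, ← runOps, htake]
      by_cases hc : m[j] ∈ m.take j
      · have h1 : (m.take j).count m[j] = 1 := by
          have h2 := hm m[j]
          have h3 := List.count_pos_iff.2 hc
          have h4 : (m.take (j + 1)).count m[j] ≤ 2 := by
            rw [← h2]; exact (List.take_sublist _ _).count_le _
          rw [htake, List.count_append, List.count_singleton_self] at h4
          omega
        simpa [letterOps, hc, GraphOp.apply] using ih.second h1
      · simpa [letterOps, hc, GraphOp.apply] using ih.first hc
    · have : costOps (letterOps (m[j] ∉ m.take j) m[j]) = 1 := by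
        by_cases hc : m[j] ∈ m.take j <;> simp [letterOps, hc, costOps, GraphOp.cost]
      rw [costOps, List.map_append, List.sum_append, ← costOps, ihc, ← costOps, this]

theorem runOps_intervalOps {n : ℕ} {m : List (Fin n)} (hm : IsDoubleOccurrence m) :
    (runOps (intervalOps m)).comap some = intervalGraph m := by
  obtain ⟨h, -⟩ := intervalOps_take hm (m.length - 2) (by omega)
  ext a b
  by_cases hab : a = b
  · subst hab; simp
  rw [intervalGraph_adj_iff hab (hm a) (hm b), SimpleGraph.comap_adj, intervalOps, h.some_adj]
  simp only [hab, ne_eq, not_false_eq_true, true_and]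
  constructor
  · rintro ⟨q, hq, h⟩
    exact ⟨q, hq.trans (List.take_prefix _ _), h⟩
  · rintro ⟨q, hq, h1, h2⟩
    refine ⟨q, ?_, h1, h2⟩
    obtain ⟨r, rfl⟩ := hq
    have ha := hm a
    have hb := hm b
    rw [List.count_append, h1] at ha
    rw [List.count_append, h2] at hb
    -- If `a` and `b` are open after `q`, then one more of each is still to come. So `q` ends before
    -- the last two letters, and these can be left unread.
    have hr : 2 ≤ r.length := by
      have hsub : [a, b].Subperm r := by
        rw [List.subperm_ext_iff]
        intro x hx
        have hba : b ≠ a := fun e => hab e.symm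
        simp only [List.mem_cons, List.not_mem_nil, or_false] at hx
        rcases hx with rfl | rfl
        · simp only [List.count_cons_self, List.count_cons_of_ne hba, List.count_nil]; omega
        · simp only [List.count_cons_self, List.count_cons_of_ne hab, List.count_nil]; omega
      simpa using hsub.length_le
    rw [List.length_append, List.take_append]
    refine List.IsPrefix.trans ?_ (List.prefix_append _ _)
    rw [List.take_of_length_le (by omega)]

theorem costOps_intervalOps {n : ℕ} {m : List (Fin n)} (hm : IsDoubleOccurrence m) :
    costOps (intervalOps m) = 2 * n - 2 := by
  obtain ⟨-, h⟩ := intervalOps_take hm (m.length - 2) (by omega)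
  rw [intervalOps, h, hm.length]

end Interval

/-! ## Circle graphs and local complementation -/

section Circle

variable {V : Type*} [DecidableEq V]

/-- The number of occurrences of the letter `a` before the letter `b`. -/
def orderedPairs (a b : V) : List V → ℕ
  | [] => 0
  | x :: l => (if x = a then l.count b else 0) + orderedPairs a b l

theorem orderedPairs_append (a b : V) (l l' : List V) :
    orderedPairs a b (l ++ l') =
      orderedPairs a b l + orderedPairs a b l' + l.count a * l'.count b := by
  induction l with
  | nil => simp [orderedPairs]
  | cons x l ih =>
    rw [List.cons_append, orderedPairs, orderedPairs, ih, List.count_append, List.count_cons]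
    by_cases h : x = a
    · simp [h]; ring
    · simp [h]

/-- Reversal turns the pairs with `b` before `a` into those with `a` before `b`. Hence the parity
changes iff both letters occur an odd number of times. -/
theorem orderedPairs_reverse {a b : V} (hab : a ≠ b) (l : List V) :
    orderedPairs a b l.reverse + orderedPairs a b l = l.count a * l.count b := by
  induction l with
  | nil => simp [orderedPairs]
  | cons x l ih =>
    have h0 : orderedPairs a b [x] = 0 := by simp [orderedPairs]
    rw [List.reverse_cons, orderedPairs_append, h0, orderedPairs, List.count_reverse,
      List.count_singleton, List.count_cons, List.count_cons]
    by_cases ha : x = a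
    · subst ha
      simp [hab]
      linarith
    · by_cases hb : x = b
      · subst hb
        simp [ha]
        linarith
      · simp [ha, hb, ih]

theorem orderedPairs_subword (a b : V) (m : List V) :
    orderedPairs a b (subword m a b) = orderedPairs a b m := by
  induction m with
  | nil => rfl
  | cons x l ih =>
    have hx : subword (x :: l) a b = if x = a ∨ x = b then x :: subword l a b
        else subword l a b := by
      simp [subword, List.filter_cons]
    rw [hx]
    split_ifs with h
    · rw [orderedPairs, orderedPairs, ih, count_subword_right]
    · have : x ≠ a := fun e => h (Or.inl e)
      rw [orderedPairs, if_neg this, zero_add, ih]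

theorem orderedPairs_eq_zero_left {a b : V} {m : List V} (h : m.count a = 0) :
    orderedPairs a b m = 0 := by
  induction m with
  | nil => rfl
  | cons x l ih =>
    rw [List.count_cons] at h
    have hx : x ≠ a := by rintro rfl; simp at h
    rw [orderedPairs, if_neg hx, ih (by omega)]

theorem orderedPairs_eq_zero_right {a b : V} {m : List V} (h : m.count b = 0) :
    orderedPairs a b m = 0 := by
  induction m with
  | nil => rfl
  | cons x l ih =>
    rw [List.count_cons] at h
    rw [orderedPairs, ih (by omega), show l.count b = 0 by omega]
    simp

/-- The words `abab` and `baba` contain 3 and 1 ordered pairs, whereas `aabb`, `abba`, `baab`,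
`bbaa` contain 4, 2, 2, 0. This parity is additive under concatenation, which makes it easier to
follow than the pattern itself. -/
theorem circleGraph_adj_iff {m : List V} (hm : IsPartialWord m) {a b : V} (hab : a ≠ b) :
    (circleGraph m).Adj a b ↔ Odd (orderedPairs a b m) := by
  have hba := hab.symm
  simp only [circleGraph, hab, ne_eq, not_false_eq_true, true_and, Alternating]
  rcases hm a with ha | ha
  · have h := count_subword_left m a b
    rw [ha] at h
    rw [orderedPairs_eq_zero_left ha]
    simp only [Nat.not_odd_zero, iff_false, not_or]
    constructor <;> intro e <;> rw [e] at h <;> simp [List.count_cons] at h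
  rcases hm b with hb | hb
  · have h := count_subword_right m a b
    rw [hb] at h
    rw [orderedPairs_eq_zero_right hb]
    simp only [Nat.not_odd_zero, iff_false, not_or]
    constructor <;> intro e <;> rw [e] at h <;> simp [List.count_cons] at h
  rw [← orderedPairs_subword]
  rcases subword_cases hab ha hb with h | h | h | h | h | h <;> rw [h] <;>
    simp [orderedPairs, hab, hba] <;> decide

theorem exists_split {m : List V} {v : V} (h : m.count v = 2) :
    ∃ A B C : List V, m = A ++ v :: (B ++ v :: C) ∧ v ∉ A ∧ v ∉ B ∧ v ∉ C := by
  obtain ⟨A, R, rfl, hA⟩ := List.eq_append_cons_of_mem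
    (List.count_pos_iff.1 (by omega : 0 < m.count v))
  rw [List.count_append, List.count_eq_zero.2 hA, List.count_cons_self] at h
  obtain ⟨B, C, rfl, hB⟩ := List.eq_append_cons_of_mem
    (List.count_pos_iff.1 (by omega : 0 < R.count v))
  rw [List.count_append, List.count_eq_zero.2 hB, List.count_cons_self] at h
  exact ⟨A, B, C, rfl, hA, hB, List.count_eq_zero.1 (by omega)⟩

theorem IsPartialWord.perm {m m' : List V} (h : IsPartialWord m) (hp : m'.Perm m) :
    IsPartialWord m' := fun a => by rw [hp.count_eq]; exact h a

theorem circleGraph_adj_split {A B C : List V} {v : V} (hA : v ∉ A) (hB : v ∉ B) (hC : v ∉ C)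
    (hm : IsPartialWord (A ++ v :: (B ++ v :: C))) (u : V) :
    (circleGraph (A ++ v :: (B ++ v :: C))).Adj v u ↔ Odd (B.count u) := by
  by_cases hu : v = u
  · subst hu
    simp [List.count_eq_zero.2 hB]
  · rw [circleGraph_adj_iff hm hu]
    have h0 : ∀ l : List V, v ∉ l → orderedPairs v u l = 0 := fun l hl =>
      orderedPairs_eq_zero_left (List.count_eq_zero.2 hl)
    have : orderedPairs v u (A ++ v :: (B ++ v :: C)) = B.count u + 2 * C.count u := by
      rw [orderedPairs_append, orderedPairs, orderedPairs_append, orderedPairs, h0 A hA, h0 B hB,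
        h0 C hC, List.count_eq_zero.2 hA, List.count_eq_zero.2 hB, List.count_append,
        List.count_cons_of_ne hu]
      simp
      ring
    rw [this, Nat.odd_add]
    simp

/-- The subword between the two occurrences of `v` is reversed. The neighbours of `v` are the
letters that occur an odd number of times in it, so by `orderedPairs_reverse` exactly the
adjacencies between two neighbours of `v` change. A letter that does not occur is isolated, and the
word stays as it is. -/
theorem exists_localCompl_circleGraph {m : List V} (hm : IsPartialWord m) (v : V) :
    ∃ m', m'.Perm m ∧ circleGraph m' = localCompl v (circleGraph m) := by
  rcases hm v with hv | hv
  · refine ⟨m, List.Perm.refl _, ?_⟩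
    have hno : ∀ u, ¬ (circleGraph m).Adj v u := by
      intro u h
      have := (circleGraph_adj_iff hm h.ne).1 h
      rw [orderedPairs_eq_zero_left hv] at this
      simp at this
    ext a b
    constructor
    · intro h
      exact ⟨h.ne, Or.inl ⟨h, fun h' => hno _ h'.1⟩⟩
    · rintro ⟨-, ⟨h, -⟩ | ⟨h, -⟩⟩
      · exact h
      · exact absurd h.1 (hno _)
  · obtain ⟨A, B, C, rfl, hA, hB, hC⟩ := exists_split hv
    have hp : (A ++ v :: (B.reverse ++ v :: C)).Perm (A ++ v :: (B ++ v :: C)) :=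
      (((List.reverse_perm B).append_right _).cons _).append_left _
    refine ⟨_, hp, ?_⟩
    ext a b
    by_cases hab : a = b
    · subst hab; simp
    rw [circleGraph_adj_iff (hm.perm hp) hab]
    simp only [localCompl, ne_eq, hab, not_false_eq_true, true_and,
      circleGraph_adj_split hA hB hC hm, circleGraph_adj_iff hm hab, ← Nat.odd_mul]
    have hr := orderedPairs_reverse hab B
    -- All ordered pairs other than those inside `B` are counted equally in both words; `f` is their
    -- number.
    have hsum : ∃ f, orderedPairs a b (A ++ v :: (B.reverse ++ v :: C)) =
          f + orderedPairs a b B.reverse ∧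
        orderedPairs a b (A ++ v :: (B ++ v :: C)) = f + orderedPairs a b B := by
      refine ⟨orderedPairs a b A + (if v = a then (B ++ v :: C).count b else 0) +
        orderedPairs a b (v :: C) + B.count a * (v :: C).count b +
        A.count a * (v :: (B ++ v :: C)).count b, ?_, ?_⟩
      · rw [orderedPairs_append, orderedPairs, orderedPairs_append, List.count_reverse]
        simp only [List.count_append, List.count_cons, List.count_reverse]
        ring
      · rw [orderedPairs_append, orderedPairs, orderedPairs_append]
        ring
    obtain ⟨f, h1, h2⟩ := hsum
    rw [h1, h2, ← hr]
    generalize orderedPairs a b B.reverse = x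
    generalize orderedPairs a b B = y
    simp only [Nat.odd_iff, Xor]
    omega

theorem exists_word_of_locallyEquivalent {m : List V} (hm : IsPartialWord m) {H : SimpleGraph V}
    (h : LocallyEquivalent (circleGraph m) H) : ∃ m', m'.Perm m ∧ circleGraph m' = H := by
  induction h with
  | refl => exact ⟨m, List.Perm.refl _, rfl⟩
  | tail _ hstep ih =>
    obtain ⟨m', hp, rfl⟩ := ih
    obtain ⟨v, rfl⟩ := hstep
    obtain ⟨m'', hp', h⟩ := exists_localCompl_circleGraph (hm.perm hp) v
    exact ⟨m'', hp'.trans hp, h⟩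

/-! ### Interval containment graphs are circle graphs -/

theorem dedup_filter (p : V → Bool) (l : List V) : (l.filter p).dedup = l.dedup.filter p := by
  induction l with
  | nil => simp
  | cons x l ih =>
    by_cases hx : p x
    · rw [List.filter_cons_of_pos hx]
      by_cases hm : x ∈ l
      · rw [List.dedup_cons_of_mem hm, List.dedup_cons_of_mem (by simp [hm, hx]), ih]
      · rw [List.dedup_cons_of_notMem hm, List.dedup_cons_of_notMem (by simp [hm]), ih,
          List.filter_cons_of_pos hx]
    · rw [List.filter_cons_of_neg hx, ih]
      by_cases hm : x ∈ l
      · rw [List.dedup_cons_of_mem hm]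
      · rw [List.dedup_cons_of_notMem hm, List.filter_cons_of_neg hx]

theorem IsIntervalContainmentGraph.isCircleGraph {G : SimpleGraph V}
    (h : IsIntervalContainmentGraph G) : IsCircleGraph G := by
  obtain ⟨m, hm, rfl⟩ := h
  have hmem : ∀ a, a ∈ m := fun a => List.count_pos_iff.1 (by rw [hm a]; omega)
  -- `List.dedup` keeps last occurrences. The new word lists the letters by increasing left ends and
  -- then by decreasing right ends; two letters alternate in it iff both lists order them alike,
  -- that is, iff one interval contains the other.
  refine ⟨(m.dedup ++ m.reverse.dedup).reverse, fun a => ?_, ?_⟩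
  · rw [List.count_reverse, List.count_append, List.count_dedup, List.count_dedup]
    simp [hmem]
  · have hsub : ∀ a b, subword (m.dedup ++ m.reverse.dedup).reverse a b =
        ((subword m a b).dedup ++ (subword m a b).reverse.dedup).reverse := by
      intro a b
      simp only [subword, List.filter_reverse, List.filter_append, ← dedup_filter]
    ext a b
    by_cases hab : a = b
    · subst hab; simp
    have hba : b ≠ a := fun e => hab e.symm
    simp only [containmentGraph, circleGraph, Nested, Alternating, hsub]
    rcases subword_cases hab (hm a) (hm b) with h | h | h | h | h | h <;> rw [h] <;>
      simp [hab, hba, List.dedup_cons_of_mem, List.dedup_cons_of_notMem]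

end Circle

/-! ## Vertices of low degree up to local complementation -/

section LowDegree

variable {V : Type*}

open Classical in
/-- The parity of the number of neighbours of `w` in `D`. -/
def nbrParity (G : SimpleGraph V) (D : Finset V) (w : V) : ZMod 2 :=
  ∑ u ∈ D, if G.Adj w u then 1 else 0

-- Modulo 2, local complementation adds the product of the neighbourhood indicators of `v` to the
-- adjacency matrix; the term for `w ∈ D` corrects the diagonal, since no loop is created.
open Classical in
theorem nbrParity_localCompl (G : SimpleGraph V) (D : Finset V) (v w : V) :
    nbrParity (localCompl v G) D w = nbrParity G D w +
      if G.Adj v w then nbrParity G D v + (if w ∈ D then 1 else 0) else 0 := by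
  have h2 : (1 : ZMod 2) + 1 = 0 := rfl
  have key : ∀ u, (if (localCompl v G).Adj w u then (1 : ZMod 2) else 0) =
      (if G.Adj w u then 1 else 0) +
        if G.Adj v w then (if G.Adj v u then 1 else 0) + (if w = u then 1 else 0) else 0 := by
    intro u
    by_cases hwu : w = u
    · subst hwu
      by_cases h : G.Adj v w <;> simp [h, h2]
    · by_cases h1 : G.Adj v w <;> by_cases h3 : G.Adj v u <;> by_cases h4 : G.Adj w u <;>
        simp [localCompl, hwu, h1, h3, h4, h2, Xor]
  rw [nbrParity, Finset.sum_congr rfl fun u _ => key u, Finset.sum_add_distrib, ← nbrParity]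
  congr 1
  split_ifs with h hw
  · rw [Finset.sum_add_distrib, ← nbrParity, Finset.sum_ite_eq, if_pos hw]
  · rw [Finset.sum_add_distrib, ← nbrParity, Finset.sum_ite_eq, if_neg hw]
  · simp

open Classical in
theorem nbrParity_erase (G : SimpleGraph V) {D : Finset V} {v : V} (hv : v ∈ D) (w : V) :
    nbrParity G (D.erase v) w = nbrParity G D w + if G.Adj w v then 1 else 0 := by
  rw [nbrParity, nbrParity, ← Finset.sum_erase_add _ _ hv, add_assoc]
  split_ifs
  · rw [show (1 : ZMod 2) + 1 = 0 from rfl, add_zero]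
  · simp

/-- The support of the stabilizer element that is the product of the generators in `D`. -/
def InSupport (G : SimpleGraph V) (D : Finset V) (w : V) : Prop :=
  w ∈ D ∨ nbrParity G D w ≠ 0

/-- When the stabilizer element acts at `v` as the identity or `X`, the local complementation leaves
the set `D` of generators as it is. -/
theorem inSupport_localCompl {G : SimpleGraph V} {D : Finset V} {v : V} (hv : nbrParity G D v = 0)
    (w : V) : InSupport (localCompl v G) D w ↔ InSupport G D w := by
  rw [InSupport, InSupport, nbrParity_localCompl, hv]
  by_cases hw : w ∈ D <;> simp [hw]

/-- Here the stabilizer element acts at `v` as `Y`. The local complementation turns this into `Z`,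
so `v` leaves `D` while the support does not grow. -/
theorem inSupport_of_localCompl_erase [DecidableEq V] {G : SimpleGraph V} {D : Finset V} {v : V}
    (hv : nbrParity G D v ≠ 0) (hvD : v ∈ D) {w : V}
    (h : InSupport (localCompl v G) (D.erase v) w) : InSupport G D w := by
  classical
  rw [InSupport] at h ⊢
  by_contra hcon
  simp only [not_or, not_not] at hcon
  obtain ⟨hw, h0⟩ := hcon
  have h1 : nbrParity G D v = 1 := by
    revert hv; generalize nbrParity G D v = z; revert z; decide
  have hadj : (localCompl v G).Adj w v ↔ G.Adj v w := by
    rw [G.adj_comm v w]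
    constructor
    · rintro ⟨-, h | h⟩
      · exact h.1
      · exact absurd h.1.2 (G.irrefl)
    · intro h
      exact ⟨h.ne, Or.inl ⟨h, fun h' => G.irrefl h'.2⟩⟩
  have := nbrParity_erase (localCompl v G) hvD w
  rcases h with h | h
  · exact hw (Finset.mem_of_mem_erase h)
  · apply h
    convert this using 1
    · congr!
    rw [nbrParity_localCompl, h0, h1, hadj]
    by_cases h' : G.Adj v w
    · simp only [h', hw, if_true, if_false]; rfl
    · simp [h']

/-- If a product of stabilizer generators has support of size at most `k + 1`, then some locally
equivalent graph has a vertex of degree at most `k`. -/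
theorem exists_low_degree [Fintype V] {k : ℕ} (D : Finset V) :
    ∀ G : SimpleGraph V, D.Nonempty → {w | InSupport G D w}.ncard ≤ k + 1 →
      ∃ H, LocallyEquivalent G H ∧ ∃ v ∈ D, (H.neighborSet v).ncard ≤ k := by
  classical
  induction D using Finset.strongInduction with
  | H D ih =>
    rintro G ⟨v, hv⟩ hk
    -- In this case the closed neighbourhood of `v` lies in the support. Otherwise a neighbour `w`
    -- of `v` outside the support is used to remove `v` from `D`.
    by_cases hN : ∀ w, G.Adj v w → InSupport G D w
    · refine ⟨G, Relation.ReflTransGen.refl, v, hv, ?_⟩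
      have hvS : v ∉ G.neighborSet v := by simp
      have hsub : insert v (G.neighborSet v) ⊆ {w | InSupport G D w} := by
        rintro w (rfl | hw)
        · exact Or.inl hv
        · exact hN w hw
      have := Set.ncard_le_ncard hsub (Set.toFinite _)
      rw [Set.ncard_insert_of_notMem hvS (Set.toFinite _)] at this
      omega
    · push Not at hN
      obtain ⟨w, hvw, hw⟩ := hN
      rw [InSupport, not_or, not_not] at hw
      have hne : (D.erase v).Nonempty := by
        rw [Finset.nonempty_iff_ne_empty]
        intro he
        have hD : D = {v} := by
          rw [← Finset.insert_erase hv, he, insert_empty_eq]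
        have := hw.2
        rw [hD, nbrParity, Finset.sum_singleton, if_pos hvw.symm] at this
        exact one_ne_zero this
      have step : ∀ G' : SimpleGraph V, LocallyEquivalent G G' → nbrParity G' D v ≠ 0 →
          {w | InSupport G' D w}.ncard ≤ k + 1 →
          ∃ H, LocallyEquivalent G H ∧ ∃ v ∈ D, (H.neighborSet v).ncard ≤ k := by
        intro G' hG' hO hk'
        obtain ⟨H, hH, u, hu, hd⟩ := ih (D.erase v) (Finset.erase_ssubset hv) (localCompl v G') hne
          ((Set.ncard_le_ncard (fun w hw => inSupport_of_localCompl_erase hO hv hw)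
            (Set.toFinite _)).trans hk')
        exact ⟨H, (hG'.tail ⟨v, rfl⟩).trans hH, u, Finset.mem_of_mem_erase hu, hd⟩
      -- If `v` has even parity, a local complementation at `w` makes it odd; it preserves the
      -- support because the parity at `w` vanishes.
      by_cases hO : nbrParity G D v = 0
      · refine step (localCompl w G) (Relation.ReflTransGen.single ⟨w, rfl⟩) ?_ ?_
        · rw [nbrParity_localCompl, hO, hw.2, if_pos hvw.symm, if_pos hv]
          decide
        · simpa only [inSupport_localCompl hw.2] using hk
      · exact step G Relation.ReflTransGen.refl hO hk

end LowDegree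

/-! ## Short cycles in multigraphs of degree four -/

section Darts

variable {E V : Type*}

/-- The initial vertex of an edge with an orientation. -/
def dartTail (s t : E → V) (d : E × Bool) : V := if d.2 then t d.1 else s d.1

/-- The opposite orientation of an edge. -/
def dartRev (d : E × Bool) : E × Bool := (d.1, !d.2)

/-- The terminal vertex of an edge with an orientation. -/
def dartHead (s t : E → V) (d : E × Bool) : V := dartTail s t (dartRev d)

theorem dartRev_rev (d : E × Bool) : dartRev (dartRev d) = d := by simp [dartRev]

theorem dartHead_rev (s t : E → V) (d : E × Bool) :
    dartHead s t (dartRev d) = dartTail s t d := by rw [dartHead, dartRev_rev]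

theorem eq_or_eq_rev {d d' : E × Bool} (h : d.1 = d'.1) : d = d' ∨ d = dartRev d' := by
  obtain ⟨e, b⟩ := d
  obtain ⟨e', b'⟩ := d'
  obtain rfl : e = e' := h
  cases b <;> cases b' <;> simp [dartRev]

end Darts

section Moore

variable {E V : Type*} [Fintype E] [DecidableEq E] [DecidableEq V]

/-- The vertices at which a set of edges has odd degree, for the multigraph whose edges have the
ends `s e` and `t e`. -/
def boundary (s t : E → V) (x : E → ZMod 2) : V → ZMod 2 :=
  ∑ e, x e • (Pi.single (s e) 1 + Pi.single (t e) 1)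

theorem boundary_add {E : Type*} [Fintype E] (s t : E → V) (x y : E → ZMod 2) :
    boundary s t (x + y) = boundary s t x + boundary s t y := by
  simp only [boundary, Pi.add_apply, add_smul, Finset.sum_add_distrib]

theorem boundary_single (s t : E → V) (e : E) :
    boundary s t (Pi.single e 1) = Pi.single (s e) 1 + Pi.single (t e) 1 := by
  rw [boundary, Finset.sum_eq_single e]
  · simp
  · intro f _ hf; simp [Pi.single_eq_of_ne hf]
  · simp

/-- The number of edges in a set of edges. -/
def weight (x : E → ZMod 2) : ℕ := (Finset.univ.filter fun e => x e ≠ 0).card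

theorem weight_add_le (x y : E → ZMod 2) : weight (x + y) ≤ weight x + weight y := by
  refine (Finset.card_le_card ?_).trans (Finset.card_union_le _ _)
  intro e
  simp only [Finset.mem_filter, Finset.mem_univ, true_and, Finset.mem_union, Pi.add_apply]
  contrapose!
  rintro ⟨h, h'⟩
  rw [h, h', add_zero]

theorem weight_single (e : E) : weight (Pi.single e 1 : E → ZMod 2) = 1 := by
  rw [weight, Finset.card_eq_one]
  refine ⟨e, ?_⟩
  ext f
  by_cases h : f = e <;> simp [Pi.single_apply, h]

theorem weight_zero {E : Type*} [Fintype E] : weight (0 : E → ZMod 2) = 0 := by simp [weight]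

theorem boundary_single_dart (s t : E → V) (d : E × Bool) :
    boundary s t (Pi.single d.1 1) =
      Pi.single (dartTail s t d) 1 + Pi.single (dartHead s t d) 1 := by
  rw [boundary_single]
  obtain ⟨e, b⟩ := d
  cases b
  · simp [dartTail, dartHead, dartRev]
  · simp [dartTail, dartHead, dartRev, add_comm]

/-- A tree of depth `k` that has grown from the two ends of the edge `e₀`: it consists of the
oriented edges in `A`, those of the last level are in `F`, and `P d` is the path to the head
of `d`. -/
structure GrownTree (s t : E → V) (e₀ : E) (k : ℕ) (A F : Finset (E × Bool))
    (P : E × Bool → E → ZMod 2) : Prop where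
  subset : F ⊆ A
  root_mem : (e₀, false) ∈ A
  card_last : F.card = 2 * 3 ^ k
  card_all : A.card + 1 = 3 ^ (k + 1)
  injOn : Set.InjOn (dartHead s t) A
  parent : ∀ d ∈ A, dartRev d ∈ A ∨ ∃ p ∈ A, p ∉ F ∧ dartTail s t d = dartHead s t p
  path_boundary : ∀ d ∈ A,
    boundary s t (P d) = Pi.single (dartHead s t d) 1 + Pi.single (s e₀) 1 ∨
      boundary s t (P d) = Pi.single (dartHead s t d) 1 + Pi.single (t e₀) 1
  path_weight : ∀ d ∈ A, weight (P d) ≤ k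
  path_support : ∀ d ∈ A, ∀ e, P d e ≠ 0 → ∃ d' ∈ A, d'.1 = e

theorem zmod_two_add_self {W : Type*} (f : W → ZMod 2) : f + f = 0 := by
  funext v
  exact CharTwo.add_self_eq_zero (f v)

/-- The new edges `y`, the two tree paths and, if these start at different ends of `e₀`, the edge
`e₀` form an even edge set of weight at most `2 * r + 1`. It is nonzero because `e` occurs only in
`y`. -/
theorem GrownTree.no_collision {s t : E → V} {e₀ : E} {r k : ℕ} {A F : Finset (E × Bool)}
    {P : E × Bool → E → ZMod 2} (h : GrownTree s t e₀ k A F P)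
    (hshort : ∀ x, boundary s t x = 0 → weight x ≤ 2 * r + 1 → x = 0) {d d' : E × Bool}
    (hd : d ∈ A) (hd' : d' ∈ A) {y : E → ZMod 2} {e : E} (he : ∀ d ∈ A, d.1 ≠ e) (hye : y e ≠ 0)
    (hy : boundary s t y = Pi.single (dartHead s t d) 1 + Pi.single (dartHead s t d') 1)
    (hw : 2 * k + weight y ≤ 2 * r) : False := by
  have hroot : ∃ w : E → ZMod 2, w e = 0 ∧ weight w ≤ 1 ∧
      boundary s t (P d + P d' + y + w) = 0 := by
    have hz : ∀ a b c : V → ZMod 2, a + c + (b + c) + (a + b) + 0 = 0 := by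
      intro a b c
      funext v
      simp only [Pi.add_apply, Pi.zero_apply]
      generalize a v = a; generalize b v = b; generalize c v = c
      revert a b c; decide
    have hz' : ∀ a b c f : V → ZMod 2, a + c + (b + f) + (a + b) + (c + f) = 0 := by
      intro a b c f
      funext v
      simp only [Pi.add_apply, Pi.zero_apply]
      generalize a v = a; generalize b v = b; generalize c v = c; generalize f v = f
      revert a b c f; decide
    have h0 : boundary s t (0 : E → ZMod 2) = 0 := by simp [boundary]
    have hee : e ≠ e₀ := fun hee => he _ h.root_mem hee.symm
    rcases h.path_boundary d hd with h1 | h1 <;> rcases h.path_boundary d' hd' with h2 | h2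
    · refine ⟨0, rfl, by simp [weight_zero], ?_⟩
      rw [boundary_add, boundary_add, boundary_add, h1, h2, hy, h0, hz]
    · refine ⟨Pi.single e₀ 1, Pi.single_eq_of_ne hee _, (weight_single _).le, ?_⟩
      rw [boundary_add, boundary_add, boundary_add, h1, h2, hy, boundary_single, hz']
    · refine ⟨Pi.single e₀ 1, Pi.single_eq_of_ne hee _, (weight_single _).le, ?_⟩
      rw [boundary_add, boundary_add, boundary_add, h1, h2, hy, boundary_single,
        add_comm (Pi.single (s e₀) 1) (Pi.single (t e₀) 1 : V → ZMod 2), hz']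
    · refine ⟨0, rfl, by simp [weight_zero], ?_⟩
      rw [boundary_add, boundary_add, boundary_add, h1, h2, hy, h0, hz]
  obtain ⟨w, hwe, hww, hb⟩ := hroot
  have hP : ∀ d ∈ A, P d e = 0 := by
    intro d hd
    by_contra hne
    obtain ⟨d', hd', h'⟩ := h.path_support d hd e hne
    exact he d' hd' h'
  have hx := hshort _ hb (by
    have h1 := weight_add_le (P d + P d' + y) w
    have h2 := weight_add_le (P d + P d') y
    have h3 := weight_add_le (P d) (P d')
    have h4 := h.path_weight d hd
    have h5 := h.path_weight d' hd'
    omega)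
  have := congrFun hx e
  simp only [Pi.add_apply, hP d hd, hP d' hd', hwe, Pi.zero_apply, zero_add, add_zero] at this
  exact hye this

/-- Each dart of the last level has three continuations, namely the four darts at its head except
its own reverse. Two new heads that coincide would close an even edge set of weight at most `2 * (k
+ 1) + 1`, which is too short. -/
theorem GrownTree.grow {s t : E → V} {e₀ : E} {r k : ℕ} {A F : Finset (E × Bool)}
    {P : E × Bool → E → ZMod 2} (h : GrownTree s t e₀ k A F P) (hk : k < r)
    (hdeg : ∀ d : E × Bool,
      (Finset.univ.filter fun d' => dartTail s t d' = dartTail s t d).card = 4)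
    (hshort : ∀ x, boundary s t x = 0 → weight x ≤ 2 * r + 1 → x = 0) :
    ∃ A' F' P', GrownTree s t e₀ (k + 1) A' F' P' := by
  classical
  let children : E × Bool → Finset (E × Bool) := fun d =>
    (Finset.univ.filter fun d' => dartTail s t d' = dartHead s t d).erase (dartRev d)
  have hmem : ∀ {d d'}, d' ∈ children d ↔ d' ≠ dartRev d ∧ dartTail s t d' = dartHead s t d := by
    intro d d'; simp [children]
  have hcard : ∀ d, (children d).card = 3 := by
    intro d
    have h4 : (Finset.univ.filter fun d' => dartTail s t d' = dartHead s t d).card = 4 :=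
      hdeg (dartRev d)
    have hmem : dartRev d ∈ Finset.univ.filter fun d' => dartTail s t d' = dartHead s t d :=
      Finset.mem_filter.2 ⟨Finset.mem_univ _, rfl⟩
    exact (Finset.card_erase_of_mem hmem).trans (by rw [h4])
  have hrev : ∀ d ∈ F, ∀ d' ∈ children d, dartRev d' ∉ A := by
    intro d hd d' hd' hA
    obtain ⟨hne, ht⟩ := hmem.1 hd'
    have : dartRev d' = d := h.injOn hA (h.subset hd) (by rw [dartHead_rev, ht])
    exact hne (by rw [← this, dartRev_rev])
  -- By `parent`, a child that is already in the tree has its reverse in the tree or continues an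
  -- inner dart `p`. The latter has the same head as `d`, hence equals `d`, which lies on the last
  -- level.
  have hnot : ∀ d ∈ F, ∀ d' ∈ children d, d' ∉ A := by
    intro d hd d' hd' hA
    rcases h.parent d' hA with h1 | ⟨p, hp, hpF, ht⟩
    · exact hrev d hd d' hd' h1
    · have : p = d := h.injOn hp (h.subset hd) (by rw [← ht, (hmem.1 hd').2])
      exact hpF (this ▸ hd)
  have hedge : ∀ d ∈ F, ∀ d' ∈ children d, ∀ a ∈ A, a.1 ≠ d'.1 := by
    intro d hd d' hd' a ha hae
    rcases eq_or_eq_rev hae with rfl | rfl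
    · exact hnot d hd _ hd' ha
    · exact hrev d hd d' hd' ha
  have hold : ∀ d ∈ F, ∀ d' ∈ children d, ∀ a ∈ A, dartHead s t d' ≠ dartHead s t a := by
    intro d hd d' hd' a ha heq
    refine h.no_collision hshort (h.subset hd) ha (hedge d hd d' hd')
      (y := Pi.single d'.1 1) (by simp) ?_ (by rw [weight_single]; omega)
    rw [boundary_single_dart, (hmem.1 hd').2, heq]
  have hnew : ∀ d₁ ∈ F, ∀ d₁' ∈ children d₁, ∀ d₂ ∈ F, ∀ d₂' ∈ children d₂,
      dartHead s t d₁' = dartHead s t d₂' → d₁' = d₂' := by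
    intro d₁ hd₁ d₁' hd₁' d₂ hd₂ d₂' hd₂' heq
    by_contra hne
    by_cases he : d₁'.1 = d₂'.1
    · rcases eq_or_eq_rev he with h1 | h1
      · exact hne h1
      -- An edge between two heads of the last level would appear as a child in both orientations;
      -- its head is then not new.
      · refine hold d₁ hd₁ d₁' hd₁' d₂ (h.subset hd₂) ?_
        rw [h1, dartHead_rev, (hmem.1 hd₂').2]
    · refine h.no_collision hshort (h.subset hd₁) (h.subset hd₂) (hedge d₁ hd₁ d₁' hd₁')
        (y := Pi.single d₁'.1 1 + Pi.single d₂'.1 1) ?_ ?_ ?_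
      · simp [Pi.single_eq_of_ne he]
      · rw [boundary_add, boundary_single_dart, boundary_single_dart, (hmem.1 hd₁').2,
          (hmem.1 hd₂').2, heq]
        have := zmod_two_add_self (Pi.single (dartHead s t d₂') 1 : V → ZMod 2)
        rw [add_add_add_comm, this, add_zero]
      · have := weight_add_le (Pi.single d₁'.1 1 : E → ZMod 2) (Pi.single d₂'.1 1)
        rw [weight_single, weight_single] at this
        omega
  let N : Finset (E × Bool) := F.biUnion children
  have hN : ∀ d', d' ∈ N → ∃ d, d ∈ F ∧ d' ∈ children d := by
    intro d' hd'; simpa [N] using hd'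
  have hcardN : N.card = 2 * 3 ^ (k + 1) := by
    rw [Finset.card_biUnion, Finset.sum_congr rfl fun d _ => hcard d, Finset.sum_const,
      h.card_last]
    · simp; ring
    · intro d₁ hd₁ d₂ hd₂ hne
      rw [Function.onFun, Finset.disjoint_left]
      intro d' h1 h2
      exact hne (h.injOn (h.subset hd₁) (h.subset hd₂)
        ((hmem.1 h1).2.symm.trans (hmem.1 h2).2))
  have hdisj : Disjoint A N := by
    rw [Finset.disjoint_right]
    intro d' hd'
    obtain ⟨d, hd, hc⟩ := hN d' hd'
    exact hnot d hd d' hc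
  choose! par hparF hparc using hN
  refine ⟨A ∪ N, N, fun d => if d ∈ A then P d else P (par d) + Pi.single d.1 1, ?_⟩
  have hNA : ∀ d ∈ N, d ∉ A := fun d hd => Finset.disjoint_right.1 hdisj hd
  refine ⟨Finset.subset_union_right, Finset.mem_union_left _ h.root_mem, hcardN, ?_, ?_, ?_, ?_, ?_,
    ?_⟩
  · rw [Finset.card_union_of_disjoint hdisj, hcardN]
    have := h.card_all
    rw [pow_succ 3 (k + 1)]
    omega
  · intro d₁ h1 d₂ h2 heq
    rcases Finset.mem_union.1 h1 with h1 | h1 <;> rcases Finset.mem_union.1 h2 with h2 | h2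
    · exact h.injOn h1 h2 heq
    · exact absurd heq.symm (hold _ (hparF _ h2) _ (hparc _ h2) _ h1)
    · exact absurd heq (hold _ (hparF _ h1) _ (hparc _ h1) _ h2)
    · exact hnew _ (hparF _ h1) _ (hparc _ h1) _ (hparF _ h2) _ (hparc _ h2) heq
  · intro d hd
    rcases Finset.mem_union.1 hd with hd | hd
    · rcases h.parent d hd with h1 | ⟨p, hp, -, ht⟩
      · exact Or.inl (Finset.mem_union_left _ h1)
      · exact Or.inr ⟨p, Finset.mem_union_left _ hp, Finset.disjoint_left.1 hdisj hp, ht⟩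
    · have hp := h.subset (hparF d hd)
      exact Or.inr ⟨par d, Finset.mem_union_left _ hp, Finset.disjoint_left.1 hdisj hp,
        (hmem.1 (hparc d hd)).2⟩
  · intro d hd
    rcases Finset.mem_union.1 hd with hd | hd
    · simpa only [if_pos hd] using h.path_boundary d hd
    · simp only [if_neg (hNA d hd), boundary_add, boundary_single_dart,
        (hmem.1 (hparc d hd)).2]
      have hz : ∀ a b c : V → ZMod 2, a + c + (a + b) = b + c := by
        intro a b c
        rw [add_add_add_comm, zmod_two_add_self, zero_add, add_comm]
      exact (h.path_boundary _ (h.subset (hparF d hd))).imp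
        (fun e => by rw [e, hz]) (fun e => by rw [e, hz])
  · intro d hd
    rcases Finset.mem_union.1 hd with hd | hd
    · simp only [if_pos hd]
      exact (h.path_weight d hd).trans (by omega)
    · simp only [if_neg (hNA d hd)]
      refine (weight_add_le _ _).trans ?_
      rw [weight_single]
      have := h.path_weight _ (h.subset (hparF d hd))
      omega
  · intro d hd e he
    rcases Finset.mem_union.1 hd with hd' | hd'
    · rw [if_pos hd'] at he
      obtain ⟨a, ha, hae⟩ := h.path_support d hd' e he
      exact ⟨a, Finset.mem_union_left _ ha, hae⟩
    · rw [if_neg (hNA d hd')] at he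
      by_cases hde : d.1 = e
      · exact ⟨d, hd, hde⟩
      · rw [Pi.add_apply, Pi.single_eq_of_ne (Ne.symm hde), add_zero] at he
        obtain ⟨a, ha, hae⟩ := h.path_support _ (h.subset (hparF d hd')) e he
        exact ⟨a, Finset.mem_union_left _ ha, hae⟩

/-- A multigraph in which all degrees are four has a short cycle. -/
theorem exists_short_cycle {s t : E → V} {r : ℕ} (e₀ : E) (W : Finset V)
    (hW : ∀ d, dartTail s t d ∈ W) (hcard : W.card + 1 < 3 ^ (r + 1))
    (hdeg : ∀ d : E × Bool,
      (Finset.univ.filter fun d' => dartTail s t d' = dartTail s t d).card = 4) :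
    ∃ x, boundary s t x = 0 ∧ weight x ≤ 2 * r + 1 ∧ x ≠ 0 := by
  by_contra! hshort
  have htree : ∀ k ≤ r, ∃ A F P, GrownTree s t e₀ k A F P := by
    intro k
    induction k with
    | zero =>
      intro _
      -- A loop is a cycle of weight one, so the tree can start from two distinct roots.
      have hloop : s e₀ ≠ t e₀ := by
        intro hl
        have := hshort (Pi.single e₀ 1) (by rw [boundary_single, hl, zmod_two_add_self])
          (by rw [weight_single]; omega)
        simpa using congrFun this e₀
      refine ⟨{(e₀, false), (e₀, true)}, {(e₀, false), (e₀, true)}, 0, subset_rfl, by simp,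
        by simp, by simp, ?_, ?_, ?_, ?_, ?_⟩
      · intro d h1 d' h2 heq
        simp only [Finset.coe_insert, Finset.coe_singleton, Set.mem_insert_iff,
          Set.mem_singleton_iff] at h1 h2
        rcases h1 with rfl | rfl <;> rcases h2 with rfl | rfl
        · rfl
        · exact absurd heq.symm hloop
        · exact absurd heq hloop
        · rfl
      · intro d hd
        left
        rcases (by simpa using hd : d = (e₀, false) ∨ d = (e₀, true)) with rfl | rfl <;>
          simp [dartRev]
      · intro d hd
        have h0 : boundary s t (0 : E → ZMod 2) = 0 := by simp [boundary]
        rcases (by simpa using hd : d = (e₀, false) ∨ d = (e₀, true)) with rfl | rfl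
        · right
          simp [dartRev, dartHead, dartTail, h0, zmod_two_add_self]
        · left
          simp [dartRev, dartHead, dartTail, h0, zmod_two_add_self]
      · simp [weight_zero]
      · simp
    | succ k ih =>
      intro hk
      obtain ⟨A, F, P, h⟩ := ih (by omega)
      exact h.grow (by omega) hdeg hshort
  obtain ⟨A, F, P, h⟩ := htree r le_rfl
  -- The tree of depth `r` has `3 ^ (r + 1) - 1` distinct heads, more than there are vertices.
  have := Finset.card_le_card_of_injOn (dartHead s t) (fun d _ => hW (dartRev d)) h.injOn
  have := h.card_all
  omega

end Moore

/-! ## The four-regular multigraph of a word -/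

section WordCycles

variable {V : Type*} [DecidableEq V]

theorem exists_positions {m : List V} (hm : IsPartialWord m) {v : V} (hv : v ∈ m) :
    ∃ i j : Fin m.length, i < j ∧ (∀ k, m.get k = v ↔ k = i ∨ k = j) ∧
      ∀ u, (circleGraph m).Adj v u ↔ Odd (((m.take j).drop (i + 1)).count u) := by
  have h2 : m.count v = 2 := (hm v).resolve_left (List.count_pos_iff.2 hv).ne'
  obtain ⟨A, B, C, rfl, hA, hB, hC⟩ := exists_split h2
  refine ⟨⟨A.length, by simp⟩, ⟨A.length + (B.length + 1), by simp⟩,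
    by rw [Fin.mk_lt_mk]; omega, ?_, ?_⟩
  · rintro ⟨k, hk⟩
    simp only [List.get_eq_getElem, Fin.mk.injEq]
    constructor
    · intro h
      by_contra! hne
      rw [List.getElem_append] at h
      split_ifs at h with h1
      · exact hA (h ▸ List.getElem_mem _)
      · rw [List.getElem_cons, dif_neg (by omega), List.getElem_append] at h
        split_ifs at h with h3
        · exact hB (h ▸ List.getElem_mem _)
        · rw [List.getElem_cons, dif_neg (by omega)] at h
          exact hC (h ▸ List.getElem_mem _)
    · rintro (rfl | rfl)
      · simp
      · simp
  · intro u
    rw [circleGraph_adj_split hA hB hC hm]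
    have : ((A ++ v :: (B ++ v :: C)).take (A.length + (B.length + 1))).drop (A.length + 1) = B := by
      rw [List.take_length_add_append, List.take_succ_cons, List.take_left]
      rw [List.drop_length_add_append]
      rfl
    simp only [this]

theorem sum_map_indicator (D : Finset V) (l : List V) :
    (l.map fun u => if u ∈ D then (1 : ZMod 2) else 0).sum = ∑ u ∈ D, (l.count u : ZMod 2) := by
  induction l with
  | nil => simp
  | cons a l ih =>
    simp only [List.map_cons, List.sum_cons, ih, List.count_cons, beq_iff_eq, Nat.cast_add,
      Finset.sum_add_distrib, Nat.cast_ite, Nat.cast_one, Nat.cast_zero, Finset.sum_ite_eq]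
    rw [add_comm]

variable {m : List V}

/-- The initial vertex of the edge that leaves a position of the cyclic word `m`. -/
def wordSource (m : List V) (i : Fin m.length) : V := m.get i

/-- The terminal vertex of the edge that leaves a position of the cyclic word `m`. -/
def wordTarget (m : List V) [NeZero m.length] (i : Fin m.length) : V := m.get (i + 1)

theorem sum_wordTarget {V : Type*} {m : List V} [NeZero m.length] {M : Type*} [AddCommMonoid M] (f : Fin m.length → V → M) :
    ∑ i, f i (wordTarget m i) = ∑ i, f (i - 1) (m.get i) := by
  exact Fintype.sum_equiv (Equiv.addRight (1 : Fin m.length)) _ _ fun i => by simp [wordTarget]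

theorem sum_get_eq {v : V} {i j : Fin m.length} (hij : i < j)
    (h : ∀ k, m.get k = v ↔ k = i ∨ k = j) {M : Type*} [AddCommMonoid M] (f : Fin m.length → M) :
    ∑ k, (if m.get k = v then f k else 0) = f i + f j := by
  have : Finset.univ.filter (fun k => m.get k = v) = {i, j} := by
    ext k; simpa using h k
  rw [← Finset.sum_filter, this, Finset.sum_pair hij.ne]

/-- At each of its two occurrences, the cyclic word enters and leaves the letter once. -/
theorem word_degree (hm : IsPartialWord m) [NeZero m.length] {v : V} (hv : v ∈ m) :
    (Finset.univ.filter fun d => dartTail (wordSource m) (wordTarget m) d = v).card = 4 := by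
  obtain ⟨i, j, hij, h, -⟩ := exists_positions hm hv
  rw [Finset.card_filter, Fintype.sum_prod_type]
  simp only [Fintype.sum_bool, dartTail, if_true, Bool.false_eq_true, if_false]
  rw [Finset.sum_add_distrib, sum_wordTarget (fun _ u => if u = v then 1 else 0)]
  have hsum : ∑ k, (if wordSource m k = v then 1 else 0) = 2 := sum_get_eq hij h fun _ => 1
  rw [hsum, sum_get_eq hij h]

theorem boundary_word [NeZero m.length] {v : V} {i j : Fin m.length} (hij : i < j)
    (h : ∀ k, m.get k = v ↔ k = i ∨ k = j) (x : Fin m.length → ZMod 2) :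
    boundary (wordSource m) (wordTarget m) x v = x i + x (i - 1) + (x j + x (j - 1)) := by
  have : boundary (wordSource m) (wordTarget m) x v =
      ∑ k, (if m.get k = v then x k else 0) +
        ∑ k, (if wordTarget m k = v then x k else 0) := by
    rw [boundary, Finset.sum_apply, ← Finset.sum_add_distrib]
    refine Finset.sum_congr rfl fun k _ => ?_
    simp only [Pi.smul_apply, Pi.add_apply, Pi.single_apply, smul_eq_mul, wordSource, mul_add,
      mul_ite, mul_one, mul_zero, eq_comm (a := v)]
  rw [this, sum_wordTarget (fun k u => if u = v then x k else 0), sum_get_eq hij h,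
    sum_get_eq hij h]
  abel

theorem boundary_eq_card {E : Type*} [Fintype E] (s t : E → V) (x : E → ZMod 2) (v : V) :
    boundary s t x v =
      ((Finset.univ.filter fun d : E × Bool => dartTail s t d = v ∧ x d.1 ≠ 0).card : ZMod 2) := by
  rw [Finset.card_filter, Fintype.sum_prod_type, boundary, Finset.sum_apply, Nat.cast_sum]
  refine Finset.sum_congr rfl fun e _ => ?_
  simp only [Fintype.sum_bool, dartTail, if_true, Bool.false_eq_true, if_false, Nat.cast_add,
    Nat.cast_ite, Nat.cast_one, Nat.cast_zero, Pi.smul_apply, Pi.add_apply, Pi.single_apply,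
    smul_eq_mul, eq_comm (a := v)]
  generalize x e = c
  have hc : c = 0 ∨ c = 1 := by revert c; decide
  rcases hc with rfl | rfl <;> simp [add_comm]

/-- The edges along the word between two positions change their membership at the letters
of `D`. -/
theorem telescope {x : ℕ → ZMod 2} {D : Finset V}
    (hD : ∀ k (hk : k + 1 < m.length), x (k + 1) + x k = if m[k + 1] ∈ D then 1 else 0)
    {i p : ℕ} (hip : i ≤ p) (hp : p < m.length) :
    x p = x i + ∑ u ∈ D, (((m.take (p + 1)).drop (i + 1)).count u : ZMod 2) := by
  induction p, hip using Nat.le_induction with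
  | base =>
    rw [List.drop_eq_nil_of_le (by simp)]
    simp
  | succ p hip ih =>
    have ht : m.take (p + 1 + 1) = m.take (p + 1) ++ [m[p + 1]] := by simp
    rw [ht, List.drop_append_of_le_length (by simp; omega), ← sum_map_indicator, List.map_append,
      List.sum_append, sum_map_indicator, ← add_assoc, ← ih (by omega), List.map_singleton,
      List.sum_singleton, ← hD p hp]
    generalize x p = a
    generalize x (p + 1) = b
    revert a b; decide

/-- A nonempty set of at most `k` edges with even degrees, and not all edges, gives a product of
stabilizer generators with small support. -/
theorem exists_small_support [Fintype V] (hm : IsPartialWord m) [NeZero m.length]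
    {x : Fin m.length → ZMod 2} (hx : boundary (wordSource m) (wordTarget m) x = 0) (hx0 : x ≠ 0)
    (hlt : weight x < m.length) :
    ∃ D : Finset V, D.Nonempty ∧ (∀ v ∈ D, v ∈ m) ∧
      {w | InSupport (circleGraph m) D w}.ncard ≤ weight x := by
  classical
  have hpos : 0 < m.length := Nat.pos_of_ne_zero (NeZero.ne _)
  -- `D` collects the letters at which the cyclic word passes from an edge in the set to an edge
  -- outside it, or conversely.
  let D : Finset V := Finset.univ.filter fun v => ∃ i, m.get i = v ∧ x i + x (i - 1) ≠ 0
  have hDm : ∀ v ∈ D, v ∈ m := by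
    intro v hv
    obtain ⟨i, rfl, -⟩ := (Finset.mem_filter.1 hv).2
    exact List.get_mem _ _
  -- By even degree at a letter, its two occurrences either both change the membership or both keep
  -- it. The change at a position thus depends only on the letter there.
  have hδ : ∀ i, x i + x (i - 1) = if m.get i ∈ D then 1 else 0 := by
    intro i
    by_cases h : m.get i ∈ D
    · rw [if_pos h]
      obtain ⟨k, hk, hne⟩ := (Finset.mem_filter.1 h).2
      obtain ⟨a, b, hab, hpos, -⟩ := exists_positions hm (List.get_mem m i)
      have hb := boundary_word hab hpos x
      rw [hx, Pi.zero_apply] at hb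
      have h1 : x k + x (k - 1) = 1 := by
        revert hne; generalize x k + x (k - 1) = c; revert c; decide
      have key : ∀ c d : ZMod 2, 0 = c + d → c = 1 → d = 1 := by decide
      have key' : ∀ c d : ZMod 2, 0 = c + d → d = 1 → c = 1 := by decide
      rcases (hpos i).1 rfl with rfl | rfl <;> rcases (hpos k).1 hk with rfl | rfl
      · exact h1
      · exact key' _ _ hb h1
      · exact key _ _ hb h1
      · exact h1
    · rw [if_neg h]
      by_contra hne
      exact h (Finset.mem_filter.2 ⟨Finset.mem_univ _, i, rfl, hne⟩)
  let X : ℕ → ZMod 2 := fun k => if h : k < m.length then x ⟨k, h⟩ else 0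
  have hX : ∀ i : Fin m.length, X i = x i := fun i => by simp [X]
  have hpred : ∀ i : Fin m.length, (i : ℕ) ≠ 0 → ((i - 1 : Fin m.length) : ℕ) = i - 1 := by
    intro i hi
    exact Fin.val_sub_one_of_ne_zero (fun h => hi (by rw [h]; rfl))
  have hstep : ∀ k (hk : k + 1 < m.length), X (k + 1) + X k = if m[k + 1] ∈ D then 1 else 0 := by
    intro k hk
    have h := hδ ⟨k + 1, hk⟩
    rw [← hX, ← hX, hpred _ (by simp)] at h
    simpa using h
  -- Between two occurrences of `v`, the membership changes once for each letter of `D` read; modulo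
  -- 2, this counts the neighbours of `v` in `D`.
  have hlast : ∀ i j : Fin m.length, i < j →
      x (j - 1) = x i + ∑ u ∈ D, (((m.take j).drop (i + 1)).count u : ZMod 2) := by
    intro i j hij
    have hj : (j : ℕ) ≠ 0 := by have := Fin.lt_def.1 hij; omega
    have hij' : (i : ℕ) ≤ j - 1 := by have := Fin.lt_def.1 hij; omega
    have := telescope hstep hij' (by omega)
    rw [Nat.sub_add_cancel (Nat.pos_of_ne_zero hj), ← hpred j hj, hX, hX] at this
    exact this
  refine ⟨D, ?_, hDm, ?_⟩
  · by_contra hne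
    rw [Finset.not_nonempty_iff_eq_empty] at hne
    -- Without changes, the edge set would be empty or contain all edges; `hx0` and `hlt` exclude
    -- both.
    have hconst : ∀ k : Fin m.length, x k = x ⟨0, hpos⟩ := by
      intro k
      have := telescope hstep (Nat.zero_le k) k.2
      rw [hne, Finset.sum_empty, add_zero, hX] at this
      rw [this, ← hX]
    have hone : ∀ k, x k ≠ 0 := by
      intro k hk
      apply hx0
      funext l
      rw [hconst l, ← hconst k, hk]; rfl
    have : weight x = m.length := by
      rw [weight, Finset.filter_true_of_mem fun k _ => hone k]; simp
    omega
  · let S : Finset V := Finset.univ.filter fun w => InSupport (circleGraph m) D w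
    have hS : {w | InSupport (circleGraph m) D w} = (S : Set V) := by ext w; simp [S]
    rw [hS, Set.ncard_coe_finset]
    let T : V → Finset (Fin m.length × Bool) := fun v =>
      Finset.univ.filter fun d => dartTail (wordSource m) (wordTarget m) d = v ∧ x d.1 ≠ 0
    -- If the edge set avoids all four edge ends at `v`, then `hδ` gives `v ∉ D` and `hlast` gives
    -- parity zero, so `v` is not in the support. Thus each support vertex has positive even degree,
    -- and the double count of edge ends bounds their number.
    have hT2 : ∀ v ∈ S, 2 ≤ (T v).card := by
      intro v hv
      have heven : ((T v).card : ZMod 2) = 0 := by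
        rw [← boundary_eq_card, hx]; rfl
      rw [ZMod.natCast_eq_zero_iff_even] at heven
      have hne : (T v).card ≠ 0 := by
        intro h0
        have hsupp : InSupport (circleGraph m) D v := (Finset.mem_filter.1 hv).2
        rw [Finset.card_eq_zero, Finset.filter_eq_empty_iff] at h0
        have hvm : v ∈ m := by
          rcases hsupp with h | h
          · exact hDm v h
          · obtain ⟨u, -, hu⟩ := Finset.exists_ne_zero_of_sum_ne_zero h
            have hadj : (circleGraph m).Adj v u := by
              by_contra hn
              exact hu (if_neg hn)
            have ho := (circleGraph_adj_iff hm hadj.ne).1 hadj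
            by_contra hvm
            rw [orderedPairs_eq_zero_left (List.count_eq_zero.2 hvm)] at ho
            simp at ho
        obtain ⟨i, j, hij, hpos, hadj⟩ := exists_positions hm hvm
        have hsrc : ∀ k, m.get k = v → x k = 0 := by
          intro k hk
          by_contra hne
          exact h0 (x := (k, false)) (Finset.mem_univ _) ⟨hk, hne⟩
        have htgt : ∀ k, m.get k = v → x (k - 1) = 0 := by
          intro k hk
          by_contra hne
          exact h0 (x := (k - 1, true)) (Finset.mem_univ _)
            ⟨by simpa [dartTail, wordTarget] using hk, hne⟩
        have hi := (hpos i).2 (Or.inl rfl)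
        have hj := (hpos j).2 (Or.inr rfl)
        rcases hsupp with h | h
        · have := hδ i
          rw [hi, if_pos h, hsrc i hi, htgt i hi] at this
          exact absurd this (by decide)
        · have hl := hlast i j hij
          rw [htgt j hj, hsrc i hi, zero_add] at hl
          apply h
          rw [hl, nbrParity]
          refine Finset.sum_congr rfl fun u _ => ?_
          simp only [hadj]
          split_ifs with ho
          · rw [ZMod.natCast_eq_one_iff_odd.2 ho]
          · rw [ZMod.natCast_eq_zero_iff_even.2 (Nat.not_odd_iff_even.1 ho)]
      obtain ⟨c, hc⟩ := heven
      omega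
    have hle : S.card * 2 ≤ ∑ v ∈ S, (T v).card := by
      rw [← smul_eq_mul, ← Finset.sum_const]
      exact Finset.sum_le_sum hT2
    have hsum : ∑ v ∈ S, (T v).card ≤ 2 * weight x := by
      rw [← Finset.card_biUnion]
      · have hsub : S.biUnion T ⊆ (Finset.univ.filter fun e => x e ≠ 0) ×ˢ Finset.univ := by
          intro d hd
          obtain ⟨v, -, hd⟩ := Finset.mem_biUnion.1 hd
          simpa using (Finset.mem_filter.1 hd).2.2
        refine (Finset.card_le_card hsub).trans ?_
        rw [Finset.card_product, weight]
        simp [mul_comm]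
      · intro v _ w _ hvw
        rw [Function.onFun, Finset.disjoint_left]
        intro d h1 h2
        exact hvw ((Finset.mem_filter.1 h1).2.1.symm.trans (Finset.mem_filter.1 h2).2.1)
    omega

theorem IsPartialWord.length (hm : IsPartialWord m) : m.length = 2 * m.toFinset.card := by
  rw [← List.sum_toFinset_count_eq_length, Finset.sum_congr rfl fun a ha =>
    (hm a).resolve_left (List.count_pos_iff.2 (by simpa using ha)).ne']
  simp [mul_comm]

/-- Every nonempty circle graph is locally equivalent to one with a vertex of low degree. -/
theorem exists_low_degree_circleGraph [Fintype V] (hm : IsPartialWord m) (hne : m ≠ []) :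
    ∃ m', m'.Perm m ∧ LocallyEquivalent (circleGraph m) (circleGraph m') ∧
      ∃ v ∈ m, ((circleGraph m').neighborSet v).ncard ≤ 2 * Nat.log 3 (m.toFinset.card + 1) := by
  classical
  set w := m.toFinset.card with hw
  set r := Nat.log 3 (w + 1) with hr
  have hlen := hm.length
  have hpos : 0 < m.length := List.length_pos_iff.2 hne
  have : NeZero m.length := ⟨hpos.ne'⟩
  -- This gives `2 * r + 1 < 2 * w = m.length`, so the short cycle cannot consist of all edges.
  have hrw : r < w := by
    by_contra! h
    have h1 : 3 ^ r ≤ w + 1 := Nat.pow_log_le_self 3 (by omega)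
    have h2 : 3 ^ w ≤ 3 ^ r := Nat.pow_le_pow_right (by norm_num) h
    have h3 : w + 1 < 3 ^ w := by
      have : 1 ≤ w := by omega
      clear_value w
      clear h1 h2 h hr hw hlen
      induction w, this using Nat.le_induction with
      | base => norm_num
      | succ k hk ih => rw [pow_succ]; omega
    omega
  have htail : ∀ d, dartTail (wordSource m) (wordTarget m) d ∈ m := by
    rintro ⟨e, b⟩
    cases b <;> exact List.get_mem _ _
  obtain ⟨x, hx, hwt, hx0⟩ := exists_short_cycle (s := wordSource m) (t := wordTarget m) (r := r)
    ⟨0, hpos⟩ m.toFinset (fun d => by simpa using htail d)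
    (Nat.lt_pow_succ_log_self (by norm_num) _) (fun d => word_degree hm (htail d))
  obtain ⟨D, hD, hDm, hS⟩ := exists_small_support hm hx hx0 (by omega)
  obtain ⟨H, hH, v, hv, hd⟩ := exists_low_degree D (circleGraph m) hD (hS.trans hwt)
  obtain ⟨m', hp, rfl⟩ := exists_word_of_locallyEquivalent hm hH
  exact ⟨m', hp, hH, v, hDm v hv, hd⟩

end WordCycles

/-! ## The algorithm for circle graphs -/

section CircleAlgorithm

variable {V : Type*}

theorem localCompl_localCompl (v : V) (G : SimpleGraph V) : localCompl v (localCompl v G) = G := by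
  have hv : ∀ u, (localCompl v G).Adj v u ↔ G.Adj v u := by
    intro u
    constructor
    · rintro ⟨-, h | h⟩
      · exact h.1
      · exact absurd h.1.1 G.irrefl
    · exact fun h => ⟨h.ne, Or.inl ⟨h, fun h' => G.irrefl h'.1⟩⟩
  ext a b
  by_cases hab : a = b
  · subst hab; simp
  have h1 : (localCompl v (localCompl v G)).Adj a b ↔
      Xor (Xor (G.Adj a b) (G.Adj v a ∧ G.Adj v b)) (G.Adj v a ∧ G.Adj v b) := by
    change (a ≠ b ∧ Xor ((localCompl v G).Adj a b)
      ((localCompl v G).Adj v a ∧ (localCompl v G).Adj v b)) ↔ _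
    rw [hv, hv]
    change (a ≠ b ∧ Xor (a ≠ b ∧ Xor (G.Adj a b) (G.Adj v a ∧ G.Adj v b)) _) ↔ _
    simp [hab]
  rw [h1]
  by_cases h2 : G.Adj a b <;> by_cases h3 : G.Adj v a ∧ G.Adj v b <;> simp [Xor, h2, h3]

theorem LocallyEquivalent.symm {G H : SimpleGraph V} (h : LocallyEquivalent G H) :
    LocallyEquivalent H G := by
  induction h with
  | refl => exact Relation.ReflTransGen.refl
  | tail _ hs ih =>
    obtain ⟨v, rfl⟩ := hs
    exact Relation.ReflTransGen.head ⟨v, (localCompl_localCompl v _).symm⟩ ih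

theorem exists_ops_of_locallyEquivalent {ops : List (GraphOp V)} {H : SimpleGraph V}
    (h : LocallyEquivalent (runOps ops) H) :
    ∃ ops', runOps ops' = H ∧ costOps ops' = costOps ops := by
  induction h with
  | refl => exact ⟨ops, rfl, rfl⟩
  | tail _ hs ih =>
    obtain ⟨v, rfl⟩ := hs
    obtain ⟨ops', rfl, hc⟩ := ih
    exact ⟨ops' ++ [.localCompl v], by simp [runOps, GraphOp.apply],
      by simpa [costOps, GraphOp.cost] using hc⟩

theorem exists_ops_add_star (ops : List (GraphOp V)) (v : V) (T : Finset V) :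
    ∃ ops', costOps ops' = costOps ops + T.card ∧ ∀ a b, (runOps ops').Adj a b ↔
      a ≠ b ∧ Xor ((runOps ops).Adj a b) ((a = v ∧ b ∈ T) ∨ (b = v ∧ a ∈ T)) := by
  classical
  induction T using Finset.induction_on with
  | empty =>
    refine ⟨ops, by simp, fun a b => ?_⟩
    simpa [Xor] using fun h : (runOps ops).Adj a b => h.ne
  | insert w T hw ih =>
    obtain ⟨ops', hc, h⟩ := ih
    refine ⟨ops' ++ [.edgeCompl v w], ?_, fun a b => ?_⟩
    · rw [Finset.card_insert_of_notMem hw, ← add_assoc, ← hc]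
      simp [costOps, GraphOp.cost]
    · have : runOps (ops' ++ [.edgeCompl v w]) = edgeCompl v w (runOps ops') := by
        simp [runOps, GraphOp.apply]
      rw [this]
      by_cases hab : a = b
      · subst hab; simp
      simp only [edgeCompl, h, Sym2.eq_iff, Finset.mem_insert, hab, ne_eq, not_false_eq_true,
        true_and]
      have hdis : (a = v ∧ b = w ∨ a = w ∧ b = v) → ¬ ((a = v ∧ b ∈ T) ∨ (b = v ∧ a ∈ T)) := by
        rintro (⟨rfl, rfl⟩ | ⟨rfl, rfl⟩) (⟨h1, h2⟩ | ⟨h1, h2⟩)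
        · exact hw h2
        · exact hab h1.symm
        · exact hab h1
        · exact hw h2
      have hsplit : ((a = v ∧ (b = w ∨ b ∈ T)) ∨ (b = v ∧ (a = w ∨ a ∈ T))) ↔
          (a = v ∧ b = w ∨ a = w ∧ b = v) ∨ ((a = v ∧ b ∈ T) ∨ (b = v ∧ a ∈ T)) := by tauto
      rw [hsplit]
      generalize (a = v ∧ b = w ∨ a = w ∧ b = v) = P at hdis ⊢
      generalize ((a = v ∧ b ∈ T) ∨ (b = v ∧ a ∈ T)) = Q at hdis ⊢
      by_cases hP : P <;> by_cases hQ : Q <;> simp_all [Xor]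

variable [DecidableEq V]

/-- Partial words allow the induction to remove letters without changing the vertex type; a removed
letter becomes an isolated vertex. -/
theorem IsPartialWord.filter_ne {m : List V} (hm : IsPartialWord m) (v : V) :
    IsPartialWord (m.filter (· ≠ v)) := by
  intro a
  by_cases h : a = v
  · subst h
    left
    simp [List.count_eq_zero]
  · rw [List.count_filter (by simpa using h)]
    exact hm a

theorem circleGraph_filter_adj {m : List V} (hm : IsPartialWord m) (v a b : V) :
    (circleGraph (m.filter (· ≠ v))).Adj a b ↔ (circleGraph m).Adj a b ∧ a ≠ v ∧ b ≠ v := by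
  have hv : ∀ b, ¬ (circleGraph (m.filter (· ≠ v))).Adj v b := by
    intro b h
    have := (circleGraph_adj_iff (hm.filter_ne v) h.ne).1 h
    rw [orderedPairs_eq_zero_left (by simp [List.count_eq_zero])] at this
    simp at this
  by_cases ha : a = v
  · subst ha; exact iff_of_false (hv b) fun h => h.2.1 rfl
  by_cases hb : b = v
  · subst hb
    rw [SimpleGraph.adj_comm]
    exact iff_of_false (hv a) fun h => h.2.2 rfl
  have : subword (m.filter (· ≠ v)) a b = subword m a b := by
    rw [subword, List.filter_filter, subword]
    congr 1
    funext x
    by_cases hx : x = v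
    · subst hx; simp [Ne.symm ha, Ne.symm hb]
    · simp [hx]
  simp only [circleGraph, Alternating, this, ha, hb, ne_eq, not_false_eq_true, and_true]

/-- A locally equivalent circle graph has a vertex `v` of low degree. The word without `v` is
handled by induction, the star at `v` is added at a cost equal to its degree, and free local
complementations lead back to the given graph. -/
theorem exists_ops_circleGraph [Fintype V] (w : ℕ) : ∀ m : List V, IsPartialWord m →
    m.toFinset.card = w → ∃ ops : List (GraphOp V), runOps ops = circleGraph m ∧
      costOps ops ≤ 2 * Nat.log 3 (w + 1) * (w - 1) := by
  classical
  induction w with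
  | zero =>
    intro m _ hw
    have : m = [] := by simpa using hw
    subst this
    refine ⟨[], ?_, by simp [costOps]⟩
    ext a b
    simp [runOps, circleGraph, Alternating, subword]
  | succ w ih =>
    intro m hm hw
    have hne : m ≠ [] := by rintro rfl; simp at hw
    obtain ⟨m', hp, hloc, v, hv, hd⟩ := exists_low_degree_circleGraph hm hne
    rw [hw] at hd
    have hm' := hm.perm hp
    obtain ⟨ops, hrun, hcost⟩ := ih (m'.filter (· ≠ v)) (hm'.filter_ne v) (by
      have : (m'.filter (· ≠ v)).toFinset = m.toFinset.erase v := by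
        ext a; simp [hp.mem_iff, and_comm]
      rw [this, Finset.card_erase_of_mem (by simpa using hv), hw]
      rfl)
    let T : Finset V := Finset.univ.filter fun u => (circleGraph m').Adj v u
    have hT : T.card = ((circleGraph m').neighborSet v).ncard := by
      rw [← Set.ncard_coe_finset]
      congr 1
      ext u; simp [T]
    obtain ⟨ops₁, hc₁, h₁⟩ := exists_ops_add_star ops v T
    have hrun₁ : runOps ops₁ = circleGraph m' := by
      ext a b
      rw [h₁, hrun, circleGraph_filter_adj hm']
      by_cases hab : a = b
      · subst hab; simp
      by_cases ha : a = v
      · subst ha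
        simp [T, Xor, hab, Ne.symm hab]
      · by_cases hb : b = v
        · subst hb
          simp [T, Xor, hab, (circleGraph m').adj_comm b a]
        · simp [Xor, ha, hb, hab]
    obtain ⟨ops₂, hrun₂, hc₂⟩ := exists_ops_of_locallyEquivalent (ops := ops₁)
      (by rw [hrun₁]; exact hloc.symm)
    refine ⟨ops₂, hrun₂, ?_⟩
    rw [hc₂, hc₁, hT]
    -- The first vertex costs nothing because `Nat.log 3 2 = 0`; it is treated apart since `w - 1`
    -- is truncated at `w = 0`.
    rcases Nat.eq_zero_or_pos w with rfl | hwpos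
    · have h0 : Nat.log 3 (0 + 1 + 1) = 0 := by simp
      rw [h0] at hd ⊢
      omega
    · have hmono : Nat.log 3 (w + 1) ≤ Nat.log 3 (w + 1 + 1) := Nat.log_mono_right (by omega)
      obtain ⟨c, rfl⟩ : ∃ c, w = c + 1 := ⟨w - 1, by omega⟩
      simp only [Nat.add_sub_cancel] at hcost ⊢
      have := Nat.mul_le_mul_right c (Nat.mul_le_mul_left 2 hmono)
      calc _ ≤ 2 * Nat.log 3 (c + 1 + 1 + 1) * c + 2 * Nat.log 3 (c + 1 + 1 + 1) := by omega
        _ = _ := by ring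

end CircleAlgorithm

/-! ## Numerical estimates -/

theorem two_div_log_three_le : 2 / Real.log 3 ≤ 1.262 / Real.log 2 := by
  have h2 : 0 < Real.log 2 := Real.log_pos (by norm_num)
  have h3 : 0 < Real.log 3 := Real.log_pos (by norm_num)
  rw [div_le_div_iff₀ h3 h2]
  -- The fraction 84/53 is a convergent of `log 3 / log 2` from below, and `1.262 * 84 / 53 > 2`.
  have h : Real.log ((2 : ℝ) ^ 84) ≤ Real.log ((3 : ℝ) ^ 53) :=
    Real.log_le_log (by positivity) (by norm_num)
  rw [Real.log_pow, Real.log_pow] at h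
  norm_num at h ⊢
  linarith

theorem two_mul_floor_logb_le {n : ℕ} :
    2 * (⌊Real.logb 3 (n + 1)⌋₊ : ℝ) ≤ 1.262 * Real.logb 2 (n + 1) := by
  have hn : 0 ≤ Real.log ((n : ℝ) + 1) := Real.log_nonneg (by linarith [n.cast_nonneg (α := ℝ)])
  have hfl : (⌊Real.logb 3 (n + 1)⌋₊ : ℝ) ≤ Real.logb 3 (n + 1) :=
    Nat.floor_le (Real.logb_nonneg (by norm_num) (by linarith [n.cast_nonneg (α := ℝ)]))
  calc 2 * (⌊Real.logb 3 (n + 1)⌋₊ : ℝ) ≤ 2 * Real.logb 3 (n + 1) := by linarith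
    _ = 2 / Real.log 3 * Real.log (n + 1) := by rw [Real.logb]; ring
    _ ≤ 1.262 / Real.log 2 * Real.log (n + 1) :=
      mul_le_mul_of_nonneg_right two_div_log_three_le hn
    _ = 1.262 * Real.logb 2 (n + 1) := by rw [Real.logb]; ring

/-- From `log (n + 1) ≤ log n + 1 / n`, the left side exceeds the right by at most `1 - 1 / n - log
n` in natural logarithms, which is not positive. -/
theorem sub_one_mul_logb_le {n : ℕ} (hn : 1 ≤ n) :
    ((n : ℝ) - 1) * Real.logb 2 (n + 1) ≤ n * Real.logb 2 n := by
  have hn' : (1 : ℝ) ≤ n := by exact_mod_cast hn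
  have h2 : 0 < Real.log 2 := Real.log_pos (by norm_num)
  rw [Real.logb, Real.logb, ← mul_div_assoc, ← mul_div_assoc]
  refine div_le_div_of_nonneg_right ?_ h2.le
  have h1 : Real.log (n + 1) ≤ Real.log n + 1 / n := by
    have : (n : ℝ) + 1 = n * (1 + 1 / n) := by field_simp
    rw [this, Real.log_mul (by positivity) (by positivity)]
    have := Real.log_le_sub_one_of_pos (show (0 : ℝ) < 1 + 1 / n by positivity)
    linarith
  have h3 : 1 - 1 / (n : ℝ) ≤ Real.log n := by
    have := Real.one_sub_inv_le_log_of_pos (show (0 : ℝ) < n by positivity)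
    rwa [one_div]
  calc ((n : ℝ) - 1) * Real.log (n + 1) ≤ (n - 1) * (Real.log n + 1 / n) :=
      mul_le_mul_of_nonneg_left h1 (by linarith)
    _ = n * Real.log n - Real.log n + (1 - 1 / n) := by field_simp
    _ ≤ n * Real.log n := by linarith

theorem circle_bound_le {n : ℕ} (hn : 1 ≤ n) :
    2 * (⌊Real.logb 3 (n + 1)⌋₊ : ℝ) * ((n : ℝ) - 1)
        ≤ 1.262 * ((n : ℝ) - 1) * Real.logb 2 (n + 1) ∧
      2 * (⌊Real.logb 3 (n + 1)⌋₊ : ℝ) * ((n : ℝ) - 1) ≤ 1.262 * n * Real.logb 2 n := by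
  have hn' : (1 : ℝ) ≤ n := by exact_mod_cast hn
  have h := mul_le_mul_of_nonneg_right (two_mul_floor_logb_le (n := n))
    (show 0 ≤ (n : ℝ) - 1 by linarith)
  exact ⟨by linarith, by linarith [sub_one_mul_logb_le hn]⟩

theorem floor_logb_three (n : ℕ) : ⌊Real.logb 3 ((n : ℝ) + 1)⌋₊ = Nat.log 3 (n + 1) := by
  exact_mod_cast Real.natFloor_logb_natCast 3 (n + 1)

theorem IsCircleGraph.czComplexity_le {n : ℕ} {G : SimpleGraph (Fin n)} (hG : IsCircleGraph G) :
    czComplexity G ≤ ((2 * ⌊Real.logb 3 (n + 1)⌋₊ * (n - 1) : ℕ) : ℕ∞) := by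
  obtain ⟨m, hm, rfl⟩ := hG
  have hcard : m.toFinset.card = n := by
    have := hm.isPartialWord.length
    rw [hm.length] at this
    omega
  obtain ⟨ops, hrun, hcost⟩ := exists_ops_circleGraph n m hm.isPartialWord hcard
  rw [← hrun, floor_logb_three]
  exact (czComplexity_runOps_le ops).trans (by exact_mod_cast hcost)

theorem IsCircleGraph.exists_low_degree {n : ℕ} (hn : 1 ≤ n) {G : SimpleGraph (Fin n)}
    (hG : IsCircleGraph G) : ∃ H : SimpleGraph (Fin n), IsCircleGraph H ∧ LocallyEquivalent G H ∧
      ∃ v, (H.neighborSet v).ncard ≤ 2 * ⌊Real.logb 3 (n + 1)⌋₊ := by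
  obtain ⟨m, hm, rfl⟩ := hG
  have hlen := hm.length
  have hcard : m.toFinset.card = n := by
    have := hm.isPartialWord.length
    omega
  obtain ⟨m', hp, hloc, v, -, hd⟩ := exists_low_degree_circleGraph hm.isPartialWord (by
    rintro rfl
    simp at hlen
    omega)
  refine ⟨circleGraph m', ⟨m', fun a => by rw [hp.count_eq]; exact hm a, rfl⟩, hloc, v, ?_⟩
  rw [hcard] at hd
  rwa [floor_logb_three]

end GraphPrep

end

/-! ### Assembly of the three graph classes -/

theorem theorem6 :
    -- interval graphs: the CZ-complexity, with one auxiliary qubit, by an explicit algorithm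
    (∀ n : ℕ, 1 ≤ n → ∀ G : SimpleGraph (Fin n), GraphPrep.IsIntervalGraph G →
      GraphPrep.czComplexity G ≤ ((2 * n - 2 : ℕ) : ℕ∞) ∧
      ∃ A : GraphPrep.QAlg n (n + 1),
        A.Generates G (GraphPrep.zeroState (n + 1)) ∧ A.cost ≤ 2 * n - 2) ∧
    (∀ n : ℕ, 1 ≤ n → ∀ m : List (Fin n), GraphPrep.IsDoubleOccurrence m →
      (GraphPrep.runOps (GraphPrep.intervalOps m)).comap some = GraphPrep.intervalGraph m ∧
      GraphPrep.costOps (GraphPrep.intervalOps m) = 2 * n - 2) ∧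
    -- circle graphs
    (∀ n : ℕ, 1 ≤ n → ∀ G : SimpleGraph (Fin n), GraphPrep.IsCircleGraph G →
      (∃ H : SimpleGraph (Fin n), GraphPrep.IsCircleGraph H ∧ GraphPrep.LocallyEquivalent G H ∧
        ∃ v, (H.neighborSet v).ncard ≤ 2 * ⌊Real.logb 3 (n + 1)⌋₊) ∧
      GraphPrep.czComplexity G ≤ ((2 * ⌊Real.logb 3 (n + 1)⌋₊ * (n - 1) : ℕ) : ℕ∞)) ∧
    (∀ n : ℕ, 1 ≤ n →
      2 * (⌊Real.logb 3 (n + 1)⌋₊ : ℝ) * ((n : ℝ) - 1)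
          ≤ 1.262 * ((n : ℝ) - 1) * Real.logb 2 (n + 1) ∧
      2 * (⌊Real.logb 3 (n + 1)⌋₊ : ℝ) * ((n : ℝ) - 1) ≤ 1.262 * n * Real.logb 2 n) ∧
    -- interval containment graphs
    (∃ C : ℝ, ∀ n : ℕ, 1 ≤ n → ∀ G : SimpleGraph (Fin n),
      GraphPrep.IsIntervalContainmentGraph G →
        ∃ k : ℕ, GraphPrep.czComplexity G = (k : ℕ∞) ∧
          (k : ℝ) ≤ 1.262 * n * Real.logb 2 n + C * n) := by
  refine ⟨fun n _ G hG => ?_, fun n _ m hm => ?_, fun n hn G hG => ?_, fun n hn => ?_, 0, ?_⟩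
  · obtain ⟨m, hm, rfl⟩ := hG
    obtain ⟨A, hA, hc⟩ := GraphPrep.exists_alg_of_runOps (GraphPrep.intervalOps m)
    rw [GraphPrep.runOps_intervalOps hm] at hA
    rw [GraphPrep.costOps_intervalOps hm] at hc
    exact ⟨(GraphPrep.czComplexity_le hA).trans (by exact_mod_cast hc), A, hA, hc⟩
  · exact ⟨GraphPrep.runOps_intervalOps hm, GraphPrep.costOps_intervalOps hm⟩
  · exact ⟨hG.exists_low_degree hn, hG.czComplexity_le⟩
  · exact GraphPrep.circle_bound_le hn
  · intro n hn G hG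
    have hle := hG.isCircleGraph.czComplexity_le
    -- The bound for circle graphs shows that the complexity is finite, hence a natural number `k`.
    obtain ⟨k, hk⟩ := ENat.ne_top_iff_exists.1 (ne_top_of_le_ne_top (ENat.natCast_ne_top _) hle)
    refine ⟨k, hk.symm, ?_⟩
    rw [← hk] at hle
    have hle' : k ≤ 2 * ⌊Real.logb 3 (n + 1)⌋₊ * (n - 1) := by exact_mod_cast hle
    have h : (k : ℝ) ≤ 2 * (⌊Real.logb 3 (n + 1)⌋₊ : ℝ) * ((n : ℝ) - 1) := by
      have hcast : ((n - 1 : ℕ) : ℝ) = (n : ℝ) - 1 := by rw [Nat.cast_sub hn, Nat.cast_one]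
      rw [← hcast]
      exact_mod_cast hle'
    rw [zero_mul, add_zero]
    exact h.trans (GraphPrep.circle_bound_le hn).2
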